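/- Let $L, L_C, L_F, N, \Lambda, D$ be natural numbers with $L_F, \Lambda, D \ge 1$, $\Lambda \le N$ and $L - L_F + 1 \ge L_C + L_F$, let $\lambda = 1$, and let $C, \eta, \sigma > 0$ and $\theta \in \mathbb{R}^D$. A dataset $x = \{x_1,\dots,x_N\}$ consists of $N$ distinct sequences in $\mathbb{R}^L$. Datasets $x \simeq_1 x'$ are $1$-event-level neighbouring if they differ in a single pair of sequences $x_n \ne x'_n$, and these differ in a single time index only. For a parametric model $f_\vartheta$ ($\vartheta \in \mathbb{R}^D$), defined on $\mathbb{R}^{L_C}$, and a real-valued loss $\mathcal{L}$ that compares predictions with targets in $\mathbb{R}^{L_F}$, let $\tilde M$ be the following training step at $\theta$. (a) Top-level sampling without replacement: draw a uniformly random permutation $\pi$ of $\{1,\dots,N\}$ and keep $x_{\pi(1)}, \dots, x_{\pi(N')}$ with $N' = \lfloor \Lambda/\lambda \rfloor$. (b) Bottom-level sampling with replacement: prepend $L_C$ zeros to each kept sequence and take from it $\lambda$ contiguous subsequences of length $L_C + L_F$, with independent start indices uniform on $\{1,\dots,L-L_F+1\}$. All subsequences $y_i$ are collected, with multiplicity,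 in one batch. (c) Split each $y_i$ into its first $L_C$ entries $y_{C,i}$ and its last $L_F$ entries $y_{F,i}$, let $g_i = \nabla_\theta \mathcal{L}(f_\theta(y_{C,i}), y_{F,i})$ and $\hat g = \sum_i g_i / \max\{1, \|g_i\|_2 / C\}$, and output $\theta - \eta\,\tilde g$ with $\tilde g = \frac{1}{\Lambda}\left(\hat g + \mathcal{N}(0, \sigma^2 C^2 I)\right)$. Let $\tilde M_x$ be the law of the output on dataset $x$. Let $H_\alpha(P\|Q) = \int \max\{\frac{dP}{dQ} - \alpha, 0\}\, dQ$ be the hockey-stick divergence, and let $\mathcal{N}(\mu,\sigma)$ be the univariate Gaussian with mean $\mu$ and standard deviation $\sigma$. Put $$r = \frac{L_C+L_F}{L-L_F+1}, \qquad \rho = \frac{\lfloor \Lambda/\lambda\rfloor}{N}, \qquad \tilde P(1) = \big((1-\rho)+\rho(1-r)\big)\,\mathcal{N}(0,\sigma) + \rho r\,\mathcal{N}(2,\sigma),$$ $$h(\alpha) = \begin{cases} H_\alpha(\tilde P(1)\,\|\,\mathcal{N}(0,\sigma)) & \text{if } \alpha \ge 1,\\ H_\alpha(\mathcal{N}(0,\sigma)\,\|\,\tilde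 P(1)) & \text{if } 0 \le \alpha < 1. \end{cases}$$ Then the per-step privacy profile, with an arbitrary model, is exactly $h$: for all $\alpha \ge 0$, $$\tilde H(\alpha) = \sup_{f, \mathcal{L}}\ \sup_{x \simeq_1 x'} H_\alpha(\tilde M_x \| \tilde M_{x'}) = h(\alpha),$$ where $f,\mathcal{L}$ run over all models with predictions in $\mathbb{R}^{L_F}$ and all losses such that $\vartheta \mapsto \mathcal{L}(f_\vartheta(c), y)$ is differentiable for all $c \in \mathbb{R}^{L_C}$, $y \in \mathbb{R}^{L_F}$. Moreover, $\sup_{x \simeq_1 x'} H_\alpha(\tilde M_x \| \tilde M_{x'}) \le h(\alpha)$ for every model $f$ and loss $\mathcal{L}$, with any space of predictions (a gradient that does not exist is read as $0$), and all $\alpha \ge 0$. The bound is tight: there is a single such differentiable pair $(f, \mathcal{L})$, with predictions in $\mathbb{R}^{L_F}$, for which $\sup_{x \simeq_1 x'} H_\alpha(\tilde M_x \| \tilde M_{x'}) = h(\alpha)$ for all $\alpha \ge 0$. -/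

import Mathlib

open MeasureTheory ProbabilityTheory
open scoped NNReal ENNReal

noncomputable section

/-- Hockey-stick divergence `H_α(P ‖ Q) = ∫ max (dP/dQ - α, 0) dQ`. The subtraction is the truncated
one of `ℝ≥0∞`, so it is the positive part. -/
def hockeyStick {E : Type*} [MeasurableSpace E] (α : ℝ≥0) (P Q : Measure E) : ℝ≥0∞ :=
  ∫⁻ o, (P.rnDeriv Q o - (α : ℝ≥0∞)) ∂Q

/-- Univariate mixture of Gaussians with means `μ`, weights `p` and common standard deviation `σ`. -/
def mixtureOfGaussians {K : ℕ} (μ p : Fin K → ℝ) (σ : ℝ≥0) : Measure ℝ :=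
  ∑ k, ENNReal.ofReal (p k) • gaussianReal (μ k) (σ ^ 2)

/-- A dataset of `N` pairwise distinct real time series of length `L`, in some enumeration. -/
abbrev Dataset (N L : ℕ) := Fin N ↪ (Fin L → ℝ)

/-- `w`-event-level neighbouring datasets: they differ in a single pair of sequences, and these differ
only in a range of `w` consecutive time indices. -/
def EventNeighbor {N L : ℕ} (w : ℕ) (x x' : Dataset N L) : Prop :=
  ∃ n : Fin N, (∀ m, m ≠ n → x m = x' m) ∧ x n ≠ x' n ∧
    ∃ t : Fin L, ∀ s : Fin L, ¬(t.val ≤ s.val ∧ s.val < t.val + w) → x n s = x' n s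

/-- The sequence `a` with `LC` zeros prepended (0-based positions `0, …, LC + L - 1`; positions past
the end are never accessed by the cropping below). -/
def prependZeros {L : ℕ} (LC : ℕ) (a : Fin L → ℝ) (i : ℕ) : ℝ :=
  if h : LC ≤ i ∧ i - LC < L then a ⟨i - LC, h.2⟩ else 0

/-- The contiguous subsequence of length `LC + LF` of the zero-padded sequence which starts at the
0-based position `t`. -/
def crop {L : ℕ} (LC LF : ℕ) (a : Fin L → ℝ) (t : ℕ) : Fin (LC + LF) → ℝ :=
  fun j => prependZeros LC a (t + j.val)

/-- The randomness used to sample one batch: a permutation of the `N` sequences and, for each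
position of the permuted list, `lam` start indices in a set of size `L - LF + 1`. All of it is
uniform and independent, i.e. the law is the uniform one on this finite type. -/
abbrev SamplingSpace (N L LF lam : ℕ) :=
  Equiv.Perm (Fin N) × (Fin N → Fin lam → Fin (L - LF + 1))

/-- The batch, as a multiset of subsequences. Top level (without replacement): the first
`⌊Λ / lam⌋` entries of the permuted dataset. Bottom level (with replacement): `lam` crops with uniform
start indices from each of them. Start indices at later positions are not used. -/
def batch {N L : ℕ} (LC LF lam Λ : ℕ) (x : Dataset N L) (ω : SamplingSpace N L LF lam) :
    Multiset (Fin (LC + LF) → ℝ) :=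
  ((Finset.univ.filter fun i : Fin N × Fin lam => i.1.val < Λ / lam).val).map
    fun i => crop LC LF (x (ω.1 i.1)) (ω.2 i.1 i.2).val

/-- Gradient in the parameters, at `θ`, of the loss of the model `f` on the subsequence `y`, which is
split into its context window (first `LC` entries) and its forecast window (last `LF` entries). -/
def exampleGradient {D LC LF : ℕ} {Z : Type*}
    (f : EuclideanSpace ℝ (Fin D) → (Fin LC → ℝ) → Z) (ℓ : Z → (Fin LF → ℝ) → ℝ)
    (θ : EuclideanSpace ℝ (Fin D)) (y : Fin (LC + LF) → ℝ) : EuclideanSpace ℝ (Fin D) :=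
  gradient (fun ϑ => ℓ (f ϑ fun i => y (Fin.castAdd LF i)) fun i => y (Fin.natAdd LC i)) θ

/-- Gradient clipping `g / max {1, ‖g‖ / C}`. -/
def clip {D : ℕ} (C : ℝ) (g : EuclideanSpace ℝ (Fin D)) : EuclideanSpace ℝ (Fin D) :=
  (max 1 (‖g‖ / C))⁻¹ • g

/-- Law of the updated parameters `θ - η • g̃`, `g̃ = Λ⁻¹ • (ĝ + 𝒩(0, σ² C² I))`, where `ĝ` is the sum of
the clipped gradients over the batch `y`. -/
def noisyTrainingStep {D LC LF : ℕ} {Z : Type*} (Λ : ℕ) (C η : ℝ) (σ : ℝ≥0)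
    (f : EuclideanSpace ℝ (Fin D) → (Fin LC → ℝ) → Z) (ℓ : Z → (Fin LF → ℝ) → ℝ)
    (θ : EuclideanSpace ℝ (Fin D)) (y : Multiset (Fin (LC + LF) → ℝ)) :
    Measure (EuclideanSpace ℝ (Fin D)) :=
  (stdGaussian (EuclideanSpace ℝ (Fin D))).map fun z =>
    θ - η • ((Λ : ℝ)⁻¹ • ((y.map fun yi => clip C (exampleGradient f ℓ θ yi)).sum
      + ((σ : ℝ) * C) • z))

/-- Output law on dataset `x` of a single training step with top-level sampling without replacement
and bottom-level sampling with replacement: the average of the law of the noisy training step over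
the uniformly distributed batch. -/
def stepMechanism {D N L LC LF : ℕ} {Z : Type*} (lam Λ : ℕ) (C η : ℝ) (σ : ℝ≥0)
    (f : EuclideanSpace ℝ (Fin D) → (Fin LC → ℝ) → Z) (ℓ : Z → (Fin LF → ℝ) → ℝ)
    (θ : EuclideanSpace ℝ (Fin D)) (x : Dataset N L) : Measure (EuclideanSpace ℝ (Fin D)) :=
  (Fintype.card (SamplingSpace N L LF lam) : ℝ≥0∞)⁻¹ •
    ∑ ω : SamplingSpace N L LF lam, noisyTrainingStep Λ C η σ f ℓ θ (batch LC LF lam Λ x ω)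

/-- Per-step privacy profile for a given model and loss: supremum of the hockey-stick divergence over
all pairs of `w`-event-level neighbouring datasets of `N` sequences of length `L`. -/
def stepProfile {D LC LF : ℕ} {Z : Type*} (w N L lam Λ : ℕ) (C η : ℝ) (σ : ℝ≥0)
    (f : EuclideanSpace ℝ (Fin D) → (Fin LC → ℝ) → Z) (ℓ : Z → (Fin LF → ℝ) → ℝ)
    (θ : EuclideanSpace ℝ (Fin D)) (α : ℝ≥0) : ℝ≥0∞ :=
  ⨆ (x : Dataset N L) (x' : Dataset N L) (_ : EventNeighbor w x x'),
    hockeyStick α (stepMechanism lam Λ C η σ f ℓ θ x) (stepMechanism lam Λ C η σ f ℓ θ x')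

/-- The loss of the model is a differentiable function of the parameters, on every subsequence. -/
def DifferentiableLoss {D LC LF : ℕ} {Z : Type*}
    (f : EuclideanSpace ℝ (Fin D) → (Fin LC → ℝ) → Z) (ℓ : Z → (Fin LF → ℝ) → ℝ) : Prop :=
  ∀ (c : Fin LC → ℝ) (y : Fin LF → ℝ), Differentiable ℝ fun ϑ => ℓ (f ϑ c) y

/-- Per-step privacy profile of the training step with an arbitrary model: the supremum also runs over
all models `f` with forecasts in `ℝ^LF` and all losses `ℓ` that are differentiable in the parameters. -/
def worstCaseStepProfile {D : ℕ} (w N L LC LF lam Λ : ℕ) (C η : ℝ) (σ : ℝ≥0)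
    (θ : EuclideanSpace ℝ (Fin D)) (α : ℝ≥0) : ℝ≥0∞ :=
  ⨆ (f : EuclideanSpace ℝ (Fin D) → (Fin LC → ℝ) → (Fin LF → ℝ))
    (ℓ : (Fin LF → ℝ) → (Fin LF → ℝ) → ℝ) (_ : DifferentiableLoss f ℓ),
    stepProfile w N L lam Λ C η σ f ℓ θ α

/-- The claimed profile: `H_α(P ‖ 𝒩(0, σ))` for `α ≥ 1` and `H_α(𝒩(0, σ) ‖ P)` for `α < 1`, where
`σ` is a standard deviation. -/
def gaussianProfile (P : Measure ℝ) (σ : ℝ≥0) (α : ℝ≥0) : ℝ≥0∞ :=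
  if 1 ≤ α then hockeyStick α P (gaussianReal 0 (σ ^ 2))
  else hockeyStick α (gaussianReal 0 (σ ^ 2)) P

end

/-! Write `p = ρ * r`, the probability that a given sequence is drawn with its start index in a
given set of `LC + LF` indices. After rescaling by `C`, one step is an affine image of a finite
average of isotropic Gaussians whose means are sums of vectors of norm at most 1.

Upper bound. Fix all randomness except the position and start index of the sequence that differs
(`relocate`). The remaining summands then cancel, so all means that need comparing are within
distance 2, and both datasets give the same law unless that sequence is drawn with a start index in
a set of `LC + LF` indices containing all those whose crop sees the changed time. Two isotropic
Gaussians at distance at most 2 are a common randomised image of `𝒩(2, σ)` and `𝒩(0, σ)`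
(`HockeyStickLE.isotropicGaussian`). Amplification by subsampling (`sum_le_mul_sum_add_of_subset`)
turns level `1 + (a - 1) / p` for this pair into level `a` for the mixture, and
`HockeyStickLE.of_mixtureOfGaussians` shows that nothing is lost compared with the pair of `Ptilde`
and `𝒩(0, σ)`. Levels below 1 follow by exchanging the two measures.

Tightness. A model whose clipped gradient is `C` or `-C` along one axis, according to whether the
crop contains a marker value, has `Ptilde` and `𝒩(0, σ)` as images of its two output laws under one
measurable map. Data processing gives the reverse inequality at every level. -/

/-- The hockey-stick divergence of order `a` of `P` from `Q` is at most `b`, expressed on events. -/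
def HockeyStickLE {E : Type*} [MeasurableSpace E] (a b : ℝ) (P Q : Measure E) : Prop :=
  ∀ A, MeasurableSet A → P.real A ≤ a * Q.real A + b

/-! ### Calculus of event-wise domination -/

section

variable {E F : Type*} [MeasurableSpace E] [MeasurableSpace F] {P Q : Measure E} {a b : ℝ}

/-- The positive part is supported on the event where the density is at least `α`, so testing this
one event suffices. No absolute continuity is needed, since `rnDeriv` ignores the singular part of
`P`. -/
theorem HockeyStickLE.hockeyStick_le {α : ℝ≥0} [IsFiniteMeasure P] [IsFiniteMeasure Q]
    (h : HockeyStickLE α b P Q) : hockeyStick α P Q ≤ ENNReal.ofReal b := by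
  set g := P.rnDeriv Q
  have hg : Measurable g := Measure.measurable_rnDeriv P Q
  set A : Set E := {o | (α : ℝ≥0∞) ≤ g o}
  have hA : MeasurableSet A := measurableSet_le measurable_const hg
  have h1 : hockeyStick α P Q = ∫⁻ o in A, (g o - α) ∂Q := by
    rw [hockeyStick, ← lintegral_indicator hA]
    refine lintegral_congr fun o => ?_
    by_cases ho : o ∈ A
    · rw [Set.indicator_of_mem ho]
    · rw [Set.indicator_of_notMem ho]
      exact tsub_eq_zero_of_le (le_of_lt (not_le.1 ho))
  have h2 : ∫⁻ o in A, (g o - α) ∂Q = ∫⁻ o in A, g o ∂Q - α * Q A := by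
    rw [lintegral_sub measurable_const]
    · simp
    · simp [ENNReal.mul_eq_top]
    · filter_upwards [ae_restrict_mem hA] with o ho using ho
  have h3 : ∫⁻ o in A, g o ∂Q ≤ P A := Measure.setLIntegral_rnDeriv_le A
  have h4 : P A ≤ α * Q A + ENNReal.ofReal b := by
    have h5 := h A hA
    have : ENNReal.ofReal (P.real A) ≤ ENNReal.ofReal (α * Q.real A) + ENNReal.ofReal b :=
      (ENNReal.ofReal_le_ofReal h5).trans ENNReal.ofReal_add_le
    rwa [ENNReal.ofReal_mul α.coe_nonneg, ofReal_measureReal, ofReal_measureReal,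
      ENNReal.ofReal_coe_nnreal] at this
  rw [h1, h2, tsub_le_iff_left]
  exact h3.trans h4

theorem hockeyStick_le_measure_univ (α : ℝ≥0) (P Q : Measure E) :
    hockeyStick α P Q ≤ P Set.univ :=
  (lintegral_mono fun _ => tsub_le_self).trans Measure.lintegral_rnDeriv_le

theorem hockeyStick_ne_top (α : ℝ≥0) (P Q : Measure E) [IsFiniteMeasure P] :
    hockeyStick α P Q ≠ ∞ :=
  ne_top_of_le_ne_top (measure_ne_top P _) (hockeyStick_le_measure_univ α P Q)

/-- Converse direction. Here `P ≪ Q` is essential: a singular part of `P` would be invisible to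
`hockeyStick` but not to events. -/
theorem hockeyStickLE_toReal (α : ℝ≥0) [IsFiniteMeasure P] [IsFiniteMeasure Q] (hPQ : P ≪ Q) :
    HockeyStickLE α (hockeyStick α P Q).toReal P Q := by
  intro A hA
  have h1 : P A ≤ α * Q A + hockeyStick α P Q := by
    calc P A = ∫⁻ o in A, P.rnDeriv Q o ∂Q := (Measure.setLIntegral_rnDeriv hPQ A).symm
      _ ≤ ∫⁻ o in A, (α + (P.rnDeriv Q o - α)) ∂Q :=
        lintegral_mono fun o => le_add_tsub
      _ = α * Q A + ∫⁻ o in A, (P.rnDeriv Q o - α) ∂Q := by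
        rw [lintegral_add_left measurable_const]; simp
      _ ≤ _ := by gcongr; exact setLIntegral_le_lintegral _ _
  have hH := hockeyStick_ne_top α P Q
  have hQ : (α : ℝ≥0∞) * Q A ≠ ∞ := ENNReal.mul_ne_top ENNReal.coe_ne_top (measure_ne_top _ _)
  have := ENNReal.toReal_mono (ENNReal.add_ne_top.2 ⟨hQ, hH⟩) h1
  rwa [ENNReal.toReal_add hQ hH, ENNReal.toReal_mul] at this

theorem HockeyStickLE.hockeyStick_le_hockeyStick {α : ℝ≥0} [IsFiniteMeasure P] [IsFiniteMeasure Q]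
    {P' Q' : Measure F} [IsFiniteMeasure P']
    (h : HockeyStickLE α (hockeyStick α P' Q').toReal P Q) :
    hockeyStick α P Q ≤ hockeyStick α P' Q' := by
  simpa [ENNReal.ofReal_toReal (hockeyStick_ne_top α P' Q')] using h.hockeyStick_le

theorem HockeyStickLE.map (h : HockeyStickLE a b P Q) {f : E → F} (hf : Measurable f) :
    HockeyStickLE a b (P.map f) (Q.map f) := by
  intro A hA
  rw [map_measureReal_apply hf hA, map_measureReal_apply hf hA]
  exact h _ (hf hA)

/-- Slice the event over the independent factor and integrate the inequality for each slice. With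
`HockeyStickLE.map` this gives data processing for randomised maps. -/
theorem HockeyStickLE.prod [IsFiniteMeasure P] [IsFiniteMeasure Q] (h : HockeyStickLE a b P Q)
    (ν : Measure F) [IsProbabilityMeasure ν] :
    HockeyStickLE a b (ν.prod P) (ν.prod Q) := by
  intro A hA
  have key : ∀ (P : Measure E) [IsFiniteMeasure P],
      Integrable (fun z => P.real (Prod.mk z ⁻¹' A)) ν ∧
        (ν.prod P).real A = ∫ z, P.real (Prod.mk z ⁻¹' A) ∂ν := by
    intro P _
    have hm : Measurable fun z => P (Prod.mk z ⁻¹' A) := measurable_measure_prodMk_left hA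
    refine ⟨?_, ?_⟩
    · refine Integrable.of_bound hm.ennreal_toReal.aestronglyMeasurable (P.real Set.univ) ?_
      refine Filter.Eventually.of_forall fun z => ?_
      rw [Real.norm_of_nonneg measureReal_nonneg]
      exact measureReal_mono (Set.subset_univ _)
    · simp only [measureReal_def]
      rw [Measure.prod_apply hA, integral_toReal hm.aemeasurable]
      exact Filter.Eventually.of_forall fun z => measure_lt_top _ _
  obtain ⟨iP, eP⟩ := key P
  obtain ⟨iQ, eQ⟩ := key Q
  rw [eP, eQ, ← integral_const_mul]
  have hb : b = ∫ _, b ∂ν := by simp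
  rw [hb, ← integral_add (iQ.const_mul a) (integrable_const _)]
  refine integral_mono iP ((iQ.const_mul a).add (integrable_const _)) fun z => ?_
  exact h _ (measurable_prodMk_left hA)

/-- Apply the inequality to the complement. This trades level `a` for `a⁻¹` and is what reduces
levels below 1 to levels above 1. -/
theorem HockeyStickLE.symm [IsProbabilityMeasure P] [IsProbabilityMeasure Q]
    (h : HockeyStickLE a b P Q) (ha : 0 < a) : HockeyStickLE a⁻¹ (a⁻¹ * (b - (1 - a))) Q P := by
  intro A hA
  have := h Aᶜ hA.compl
  rw [probReal_compl_eq_one_sub hA, probReal_compl_eq_one_sub hA] at this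
  rw [← mul_add, le_inv_mul_iff₀ ha]
  linarith

end

/-! ### Isotropic Gaussians as images of one-dimensional ones -/

section

variable {E : Type*} [NormedAddCommGroup E] [InnerProductSpace ℝ E] [FiniteDimensional ℝ E]
  [MeasurableSpace E] [BorelSpace E]

/-- The Gaussian measure with mean `m` and covariance `σ ^ 2` times the identity. -/
noncomputable def isotropicGaussian (σ : ℝ≥0) (m : E) : Measure E :=
  (stdGaussian E).map fun z => m + (σ : ℝ) • z

instance (σ : ℝ≥0) (m : E) : IsProbabilityMeasure (isotropicGaussian σ m) :=
  Measure.isProbabilityMeasure_map (by fun_prop)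

theorem charFunDual_isotropicGaussian (σ : ℝ≥0) (m : E) (l : StrongDual ℝ E) :
    charFunDual (isotropicGaussian σ m) l =
      Complex.exp (l m * Complex.I - σ ^ 2 * ‖l‖ ^ 2 / 2) := by
  have h : isotropicGaussian σ m =
      ((stdGaussian E).map ((σ : ℝ) • ContinuousLinearMap.id ℝ E)).map (fun z => m + z) := by
    rw [Measure.map_map (by fun_prop) (by fun_prop)]
    rfl
  rw [h, charFunDual_map_const_add, charFunDual_map, charFunDual_stdGaussian, ← Complex.exp_add]
  have : l.comp ((σ : ℝ) • ContinuousLinearMap.id ℝ E) = (σ : ℝ) • l := by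
    ext; simp
  rw [this, norm_smul]
  congr 1
  simp [mul_pow]
  ring

/-- Adding an independent Gaussian in direction `v` to a suitably squeezed isotropic Gaussian
gives an isotropic Gaussian. -/
theorem map_prod_gaussianReal_eq_isotropicGaussian (σ : ℝ≥0) (c v : E) (hv : ‖v‖ ≤ 1) (μ : ℝ) :
    ((stdGaussian E).prod (gaussianReal μ (σ ^ 2))).map
      (fun p => c + ((σ : ℝ) • (p.1 - ((1 + √(1 - ‖v‖ ^ 2))⁻¹ * inner ℝ v p.1) • v) + p.2 • v)) =
      isotropicGaussian σ (c + μ • v) := by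
  set κ : ℝ := (1 + √(1 - ‖v‖ ^ 2))⁻¹
  -- `κ` is chosen so that `(I - κ v vᵀ)² = I - v vᵀ`: the squeezed Gaussian lacks exactly the
  -- covariance that the noise along `v` puts back.
  have hκ : 2 * κ - κ ^ 2 * ‖v‖ ^ 2 = 1 := by
    have hs : √(1 - ‖v‖ ^ 2) ^ 2 = 1 - ‖v‖ ^ 2 :=
      Real.sq_sqrt (by nlinarith [norm_nonneg v])
    have hq : ‖v‖ ^ 2 = 1 - √(1 - ‖v‖ ^ 2) ^ 2 := by linarith
    have hpos : 1 + √(1 - ‖v‖ ^ 2) ≠ 0 := by positivity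
    rw [hq]
    simp only [κ]
    generalize √(1 - ‖v‖ ^ 2) = s at *
    field_simp
    ring
  let T : E →L[ℝ] E := (σ : ℝ) •
    (ContinuousLinearMap.id ℝ E - κ • (innerSL ℝ v).smulRight v)
  let U : ℝ →L[ℝ] E := (ContinuousLinearMap.id ℝ ℝ).smulRight v
  have hmap : (fun p : E × ℝ =>
      c + ((σ : ℝ) • (p.1 - (κ * inner ℝ v p.1) • v) + p.2 • v)) =
      (fun z => c + z) ∘ (T.coprod U) := by
    ext p
    simp [T, U, smul_smul]
  rw [hmap, ← Measure.map_map (by fun_prop) (by fun_prop)]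
  apply Measure.ext_of_charFunDual
  ext l
  rw [charFunDual_map_const_add, charFunDual_map, charFunDual_prod, charFunDual_isotropicGaussian,
    charFunDual_stdGaussian]
  obtain ⟨w, rfl⟩ := (InnerProductSpace.toDual ℝ E).surjective l
  have e1 : ((InnerProductSpace.toDual ℝ E w).comp (T.coprod U)).comp (.inl ℝ E ℝ) =
      InnerProductSpace.toDual ℝ E ((σ : ℝ) • (w - (κ * inner ℝ v w) • v)) := by
    ext z
    simp [T, U, inner_sub_right, real_inner_smul_right,
      real_inner_comm]
    ring_nf
    simp
  have e2 : charFunDual (gaussianReal μ (σ ^ 2))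
      (((InnerProductSpace.toDual ℝ E w).comp (T.coprod U)).comp (.inr ℝ E ℝ)) =
      Complex.exp ((inner ℝ w v : ℝ) * μ * Complex.I - σ ^ 2 * (inner ℝ w v : ℝ) ^ 2 / 2) := by
    have : charFunDual (gaussianReal μ (σ ^ 2))
      (((InnerProductSpace.toDual ℝ E w).comp (T.coprod U)).comp (.inr ℝ E ℝ)) =
      charFun (gaussianReal μ (σ ^ 2)) (inner ℝ w v) := by
      rw [charFunDual_apply, charFun_apply_real]
      simp [T, U, mul_comm]
    rw [this, charFun_gaussianReal]
    push_cast
    rfl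
  have e3 : ‖(σ : ℝ) • (w - (κ * inner ℝ v w) • v)‖ ^ 2 =
      σ ^ 2 * (‖w‖ ^ 2 - inner ℝ w v ^ 2) := by
    rw [norm_smul, mul_pow, norm_sub_sq_real, norm_smul, real_inner_smul_right,
      real_inner_comm w v]
    simp only [Real.norm_eq_abs, NNReal.abs_eq, mul_pow, sq_abs]
    linear_combination (-(σ : ℝ) ^ 2 * inner ℝ w v ^ 2) * hκ
  rw [e1, e2, LinearIsometryEquiv.norm_map, LinearIsometryEquiv.norm_map, ← Complex.ofReal_pow, e3,
    ← Complex.exp_add, ← Complex.exp_add]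
  congr 1
  simp only [InnerProductSpace.toDual_apply_apply, inner_add_right, real_inner_smul_right]
  push_cast
  ring

theorem gaussianReal_absolutelyContinuous_gaussianReal {v : ℝ≥0} (hv : v ≠ 0) (μ μ' : ℝ) :
    gaussianReal μ v ≪ gaussianReal μ' v :=
  (gaussianReal_absolutelyContinuous μ hv).trans (gaussianReal_absolutelyContinuous' μ' hv)

theorem HockeyStickLE.isotropicGaussian {a b : ℝ} {σ : ℝ≥0}
    (h : HockeyStickLE a b (gaussianReal 2 (σ ^ 2)) (gaussianReal 0 (σ ^ 2))) {m m' : E}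
    (hm : ‖m - m'‖ ≤ 2) : HockeyStickLE a b (isotropicGaussian σ m) (isotropicGaussian σ m') := by
  -- With direction `(m - m') / 2`, the means 2 and 0 on the line are sent to `m` and `m'` by the
  -- same map.
  have hv : ‖(2 : ℝ)⁻¹ • (m - m')‖ ≤ 1 := by
    rw [norm_smul]; norm_num; linarith
  have e := map_prod_gaussianReal_eq_isotropicGaussian σ m' _ hv
  have e2 := e 2
  have e0 := e 0
  rw [smul_smul] at e2
  norm_num at e2 e0
  rw [← e2, ← e0]
  exact (h.prod _).map (by fun_prop)

theorem isotropicGaussian_absolutelyContinuous {σ : ℝ≥0} (hσ : σ ≠ 0) (m m' : E) :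
    isotropicGaussian σ m ≪ isotropicGaussian σ m' := by
  set u := m - m'
  -- Normalising by `1 + ‖u‖` rather than `‖u‖` also covers `u = 0`.
  have hv : ‖(1 + ‖u‖)⁻¹ • u‖ ≤ 1 := by
    rw [norm_smul, norm_inv, Real.norm_of_nonneg (by positivity), inv_mul_le_one₀ (by positivity)]
    linarith
  have e := map_prod_gaussianReal_eq_isotropicGaussian σ m' _ hv
  have e1 := e (1 + ‖u‖)
  have e0 := e 0
  rw [smul_smul, mul_inv_cancel₀ (by positivity), one_smul, add_sub_cancel] at e1
  rw [zero_smul, add_zero] at e0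
  rw [← e1, ← e0]
  refine Measure.AbsolutelyContinuous.map (Measure.AbsolutelyContinuous.rfl.prod ?_) (by fun_prop)
  exact gaussianReal_absolutelyContinuous_gaussianReal (pow_ne_zero 2 hσ) _ _

end

theorem map_stdGaussian_coord {D : ℕ} (i : Fin D) :
    (stdGaussian (EuclideanSpace ℝ (Fin D))).map (fun z => z i) = gaussianReal 0 1 := by
  have := (measurePreserving_eval_multivariateGaussian (μ := (0 : EuclideanSpace ℝ (Fin D)))
    Matrix.PosSemidef.one (i := i)).map_eq
  simpa [multivariateGaussian_zero_one] using this

/-! ### Re-randomising one sampled item -/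

section

variable {ι S : Type*} [DecidableEq ι]

/-- Move the item `n` to position `js.1` of a random list of labelled items, with label `js.2`.
The reference position `z` makes the other items independent of `js`, up to one exchange. -/
def relocate (n z : ι) (ω : Equiv.Perm ι × (ι → S)) (js : ι × S) : Equiv.Perm ι × (ι → S) :=
  (ω.1 * (Equiv.swap (ω.1.symm n) z * Equiv.swap z js.1),
    Function.update (fun k => ω.2 ((Equiv.swap (ω.1.symm n) z * Equiv.swap z js.1) k)) js.1 js.2)

theorem relocate_fst_symm (n z : ι) (ω : Equiv.Perm ι × (ι → S)) (js : ι × S) :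
    (relocate n z ω js).1.symm n = js.1 := by
  rw [Equiv.symm_apply_eq]
  simp [relocate]

theorem relocate_snd_self (n z : ι) (ω : Equiv.Perm ι × (ι → S)) (js : ι × S) :
    (relocate n z ω js).2 js.1 = js.2 := by
  simp [relocate]

/-- Relocating back to the old position and label undoes the move. This reversibility makes
resampling these two data preserve the uniform law. -/
theorem relocate_relocate (n z : ι) (ω : Equiv.Perm ι × (ι → S)) (js : ι × S) :
    relocate n z (relocate n z ω js) (ω.1.symm n, ω.2 (ω.1.symm n)) = ω := by
  have h1 := relocate_fst_symm n z ω js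
  rw [relocate, h1]
  set i := ω.1.symm n with hi
  have hσ : (Equiv.swap i z * Equiv.swap z js.1) * (Equiv.swap js.1 z * Equiv.swap z i) = 1 := by
    rw [Equiv.swap_comm js.1 z, Equiv.swap_comm z i, mul_assoc, Equiv.swap_mul_self_mul,
      Equiv.swap_mul_self]
  refine Prod.ext ?_ ?_
  · simp only [relocate, ← hi]
    rw [mul_assoc, hσ, mul_one]
  · funext k
    simp only [relocate, ← hi, Function.update_apply]
    by_cases hk : k = i
    · simp [hk]
    · have hk' : (Equiv.swap js.1 z * Equiv.swap z i) k ≠ js.1 := by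
        intro h
        have := congrArg ((Equiv.swap i z * Equiv.swap z js.1)) h
        rw [← Equiv.Perm.mul_apply, hσ] at this
        simp at this
        exact hk this
      rw [if_neg hk, if_neg hk', ← Equiv.Perm.mul_apply, hσ, Equiv.Perm.one_apply]

/-- Averaging over the position and label of a fixed item does not change the average. -/
theorem sum_relocate [Fintype ι] [Fintype S] {M : Type*} [AddCommMonoid M] (n z : ι)
    (F : Equiv.Perm ι × (ι → S) → M) :
    ∑ ω, ∑ js, F (relocate n z ω js) = Fintype.card (ι × S) • ∑ ω, F ω := by
  rw [← Finset.card_univ (α := ι × S), ← Finset.sum_const, Finset.sum_comm' (t' := Finset.univ)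
    (s' := fun _ => Finset.univ) (by simp), ← Finset.sum_product', ← Finset.sum_product']
  -- Exchange the prescribed position and label with the current ones; the result is an involution
  -- on pairs, which reindexes the double sum.
  let e : (ι × S) × (Equiv.Perm ι × (ι → S)) → (ι × S) × (Equiv.Perm ι × (ι → S)) :=
    fun q => ((q.2.1.symm n, q.2.2 (q.2.1.symm n)), relocate n z q.2 q.1)
  have he : Function.Involutive e := by
    rintro ⟨js, ω⟩
    simp only [e, relocate_fst_symm, relocate_snd_self, relocate_relocate]
  exact Fintype.sum_equiv he.toPerm _ _ fun q => rfl

/-- The sum of the values of the labelled items at the positions in `K`. -/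
def sampleSum {V : Type*} [AddCommMonoid V] (K : Finset ι) (G : ι → S → V)
    (ω : Equiv.Perm ι × (ι → S)) : V :=
  ∑ k ∈ K, G (ω.1 k) (ω.2 k)

/-- Only the first summand depends on `js`. If `n` lands in `K`, the item it displaces goes to `z ∈
K` and stays in the sum; if it lands outside, the displaced item takes its place in the sum. The
other `K.card - 1` items are unaffected. -/
theorem sampleSum_relocate {V : Type*} [AddCommMonoid V] {K : Finset ι} (G : ι → S → V)
    (n : ι) {z : ι} (hz : z ∈ K) (ω : Equiv.Perm ι × (ι → S)) (js : ι × S) :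
    sampleSum K G (relocate n z ω js) =
      (if js.1 ∈ K then G n js.2 else G (ω.1 (Equiv.swap (ω.1.symm n) z js.1))
        (ω.2 (Equiv.swap (ω.1.symm n) z js.1))) +
      ∑ k ∈ K.erase z, G (ω.1 (Equiv.swap (ω.1.symm n) z k))
        (ω.2 (Equiv.swap (ω.1.symm n) z k)) := by
  obtain ⟨j, s⟩ := js
  set i := ω.1.symm n with hi
  have hn : ω.1 i = n := by simp [hi]
  have hoff : ∀ k, k ≠ j → G ((relocate n z ω (j, s)).1 k) ((relocate n z ω (j, s)).2 k) =
      G (ω.1 (Equiv.swap i z (Equiv.swap z j k))) (ω.2 (Equiv.swap i z (Equiv.swap z j k))) := by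
    intro k hk
    simp [relocate, ← hi, Function.update_of_ne hk]
  have hself : G ((relocate n z ω (j, s)).1 j) ((relocate n z ω (j, s)).2 j) = G n s := by
    simp [relocate, ← hi, hn]
  unfold sampleSum
  by_cases hj : j ∈ K
  · simp only [if_pos hj]
    rw [← Finset.add_sum_erase K _ hj, hself]
    congr 1
    refine Finset.sum_bij' (fun k _ => Equiv.swap z j k) (fun k _ => Equiv.swap z j k) ?_ ?_ ?_ ?_ ?_
    · intro k hk
      rw [Finset.mem_erase] at hk ⊢
      refine ⟨fun h => hk.1 ?_, ?_⟩
      · have := congrArg (Equiv.swap z j) h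
        simpa using this
      · rw [Equiv.swap_apply_def]; split_ifs <;> simp_all
    · intro k hk
      rw [Finset.mem_erase] at hk ⊢
      refine ⟨fun h => hk.1 ?_, ?_⟩
      · have := congrArg (Equiv.swap z j) h
        simpa using this
      · rw [Equiv.swap_apply_def]; split_ifs <;> simp_all
    · intro k _; simp
    · intro k _; simp
    · intro k hk
      exact hoff k (Finset.ne_of_mem_erase hk)
  · simp only [if_neg hj]
    have hzj : z ≠ j := fun h => hj (h ▸ hz)
    rw [← Finset.add_sum_erase K _ hz, hoff z hzj, Equiv.swap_apply_left]
    congr 1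
    refine Finset.sum_congr rfl fun k hk => ?_
    have hkj : k ≠ j := fun h => hj (h ▸ Finset.mem_of_mem_erase hk)
    rw [hoff k hkj, Equiv.swap_apply_of_ne_of_ne (Finset.ne_of_mem_erase hk) hkj]

end

/-! ### Amplification by subsampling -/

/-- Amplification by subsampling for finite averages: if the terms outside `J` agree, and the terms
in `J` are dominated at level `1 + (a - 1) |I| / |J|`, then the sums are dominated at level `a`. -/
theorem sum_le_mul_sum_add_of_subset {I : Type*} [Fintype I] (J : Finset I)
    (hJ : J.Nonempty) {u u' : I → ℝ} {a b : ℝ} (ha : 1 ≤ a)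
    (hself : ∀ i ∈ J, u i ≤ (1 + (a - 1) * (Fintype.card I / J.card)) * u' i + b)
    (hother : ∀ i ∈ J, ∀ l ∉ J, u i ≤ (1 + (a - 1) * (Fintype.card I / J.card)) * u l + b)
    (heq : ∀ i ∉ J, u i = u' i) :
    ∑ i, u i ≤ a * ∑ i, u' i + J.card * b := by
  classical
  have hcard : (Fintype.card I : ℝ) = J.card + (Jᶜ.card : ℝ) := by
    rw [← Nat.cast_add, Finset.card_add_card_compl]
  have he : (0 : ℝ) < J.card := by exact_mod_cast hJ.card_pos
  have hc : (0 : ℝ) ≤ Jᶜ.card := by positivity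
  set e : ℝ := (J.card : ℝ)
  set c : ℝ := (Jᶜ.card : ℝ) with hcdef
  set κ : ℝ := 1 + (a - 1) * (Fintype.card I / e) with hκ
  have hκe : κ * e = a * e + (a - 1) * c := by
    rw [hκ, hcard]; field_simp; ring
  have h1 : ∑ i ∈ J, u i ≤ κ * ∑ i ∈ J, u' i + e * b := by
    calc ∑ i ∈ J, u i ≤ ∑ i ∈ J, (κ * u' i + b) := Finset.sum_le_sum hself
      _ = _ := by simp [Finset.sum_add_distrib, Finset.mul_sum, e]
  -- Comparing every term of `J` with every term outside it spends part of the mass common to both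
  -- sums.
  have h2 : c * ∑ i ∈ J, u i ≤ κ * (e * ∑ l ∈ Jᶜ, u l) + e * (c * b) := by
    calc c * ∑ i ∈ J, u i = ∑ i ∈ J, ∑ l ∈ Jᶜ, u i := by
          simp [hcdef, Finset.mul_sum]
      _ ≤ ∑ i ∈ J, ∑ l ∈ Jᶜ, (κ * u l + b) :=
          Finset.sum_le_sum fun i hi => Finset.sum_le_sum fun l hl =>
            hother i hi l (Finset.mem_compl.1 hl)
      _ = _ := by
          simp only [Finset.sum_add_distrib, Finset.sum_const, nsmul_eq_mul, ← Finset.mul_sum]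
          ring
  have h3 : ∑ l ∈ Jᶜ, u l = ∑ l ∈ Jᶜ, u' l :=
    Finset.sum_congr rfl fun l hl => heq l (Finset.mem_compl.1 hl)
  rw [← Finset.sum_add_sum_compl J u, ← Finset.sum_add_sum_compl J u', ← h3]
  have hpos : 0 < a * e + (a - 1) * c := by nlinarith
  -- Combine `h1` and `h2` with weights `a * e` and `a - 1`. By `hκe` the total weight of `∑ i ∈ J,
  -- u i` is `κ * e`, which cancels.
  have hmul : (a * e + (a - 1) * c) * ∑ i ∈ J, u i ≤
      (a * e + (a - 1) * c) * (a * ∑ i ∈ J, u' i + e * b + (a - 1) * ∑ l ∈ Jᶜ, u l) := by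
    have h1' := mul_le_mul_of_nonneg_left h1 (by nlinarith : 0 ≤ a * e)
    have h2' := mul_le_mul_of_nonneg_left h2 (by linarith : 0 ≤ a - 1)
    calc _ ≤ a * e * (κ * ∑ i ∈ J, u' i + e * b)
          + (a - 1) * (κ * (e * ∑ l ∈ Jᶜ, u l) + e * (c * b)) := by linarith
      _ = _ := by linear_combination (a * ∑ i ∈ J, u' i + (a - 1) * ∑ l ∈ Jᶜ, u l) * hκe
  have := le_of_mul_le_mul_left hmul hpos
  linarith

section

variable {ι S : Type*} [DecidableEq ι] [Fintype ι] [Fintype S]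
  {E : Type*} [NormedAddCommGroup E] [InnerProductSpace ℝ E] [FiniteDimensional ℝ E]
  [MeasurableSpace E] [BorelSpace E]

/-- Conditionally on `ω`, the index `js` plays the role of the subsampled index and `K ×ˢ T` is the
event that the difference is visible. After cancelling the common rest, two means differ by two
vectors of norm at most 1, hence the distance 2. -/
theorem sum_isotropicGaussian_sampleSum_le {K : Finset ι} (hK : K.Nonempty) {T : Finset S}
    (hT : T.Nonempty) {G G' : ι → S → E} (n : ι) (hG : ∀ m s, ‖G m s‖ ≤ 1)
    (hG' : ∀ m s, ‖G' m s‖ ≤ 1) (hne : ∀ m, m ≠ n → G m = G' m) (heq : ∀ s ∉ T, G n s = G' n s)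
    {σ : ℝ≥0} {a b : ℝ} (ha : 1 ≤ a)
    (h : HockeyStickLE (1 + (a - 1) * (Fintype.card (ι × S) / (K ×ˢ T).card)) b
      (gaussianReal 2 (σ ^ 2)) (gaussianReal 0 (σ ^ 2))) {A : Set E} (hA : MeasurableSet A) :
    Fintype.card (ι × S) * ∑ ω, (isotropicGaussian σ (sampleSum K G ω)).real A ≤
      a * (Fintype.card (ι × S) * ∑ ω, (isotropicGaussian σ (sampleSum K G' ω)).real A) +
      Fintype.card (Equiv.Perm ι × (ι → S)) * ((K ×ˢ T).card * b) := by
  obtain ⟨z, hz⟩ := hK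
  have hcard : ∀ F : Equiv.Perm ι × (ι → S) → ℝ, Fintype.card (ι × S) * ∑ ω, F ω =
      ∑ ω, ∑ js, F (relocate n z ω js) := fun F => by
    rw [sum_relocate, nsmul_eq_mul]
  rw [hcard, hcard, Finset.mul_sum, ← nsmul_eq_mul, ← Finset.card_univ, ← Finset.sum_const,
    ← Finset.sum_add_distrib]
  refine Finset.sum_le_sum fun ω _ => ?_
  have hrest : ∑ k ∈ K.erase z, G (ω.1 (Equiv.swap (ω.1.symm n) z k))
        (ω.2 (Equiv.swap (ω.1.symm n) z k)) = ∑ k ∈ K.erase z,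
        G' (ω.1 (Equiv.swap (ω.1.symm n) z k)) (ω.2 (Equiv.swap (ω.1.symm n) z k)) := by
    refine Finset.sum_congr rfl fun k hk => ?_
    rw [hne]
    intro h
    have h' := congrArg (fun m => Equiv.swap (ω.1.symm n) z (ω.1.symm m)) h
    simp at h'
    exact Finset.ne_of_mem_erase hk h'
  refine sum_le_mul_sum_add_of_subset (K ×ˢ T) (Finset.Nonempty.product ⟨z, hz⟩ hT) ha ?_ ?_ ?_
  · intro js _
    refine h.isotropicGaussian ?_ A hA
    rw [sampleSum_relocate _ _ hz, sampleSum_relocate _ _ hz, hrest, add_sub_add_right_eq_sub]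
    refine (norm_sub_le _ _).trans ?_
    split_ifs <;> linarith [hG n js.2, hG' n js.2,
      hG (ω.1 (Equiv.swap (ω.1.symm n) z js.1)) (ω.2 (Equiv.swap (ω.1.symm n) z js.1)),
      hG' (ω.1 (Equiv.swap (ω.1.symm n) z js.1)) (ω.2 (Equiv.swap (ω.1.symm n) z js.1))]
  · intro js _ l _
    refine h.isotropicGaussian ?_ A hA
    rw [sampleSum_relocate _ _ hz, sampleSum_relocate _ _ hz, add_sub_add_right_eq_sub]
    refine (norm_sub_le _ _).trans ?_
    have hle : ∀ js : ι × S, ‖if js.1 ∈ K then G n js.2 else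
        G (ω.1 (Equiv.swap (ω.1.symm n) z js.1)) (ω.2 (Equiv.swap (ω.1.symm n) z js.1))‖ ≤ 1 := by
      intro js
      split_ifs <;> exact hG _ _
    linarith [hle js, hle l]
  · intro js hjs
    rw [sampleSum_relocate _ _ hz, sampleSum_relocate _ _ hz, hrest]
    by_cases hj : js.1 ∈ K
    · have : js.2 ∉ T := fun h => hjs (Finset.mem_product.2 ⟨hj, h⟩)
      rw [if_pos hj, if_pos hj, heq _ this]
    -- The displaced item is not `n`: after the first swap `n` sits at `z ∈ K`, whereas `js.1 ∉ K`.
    · rw [if_neg hj, if_neg hj, hne]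
      intro h
      have h' := congrArg (fun m => Equiv.swap (ω.1.symm n) z (ω.1.symm m)) h
      simp at h'
      exact hj (h' ▸ hz)

end

/-! ### Finite mixtures and the dominating pair -/

section

variable {Ω E F : Type*} [Fintype Ω] [MeasurableSpace E] [MeasurableSpace F]

/-- The average of finitely many measures. -/
noncomputable def uniformMixture (κ : Ω → Measure E) : Measure E :=
  (Fintype.card Ω : ℝ≥0∞)⁻¹ • ∑ ω, κ ω

theorem uniformMixture_map (κ : Ω → Measure E) {f : E → F} (hf : Measurable f) :
    (uniformMixture κ).map f = uniformMixture fun ω => (κ ω).map f := by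
  simp_rw [uniformMixture, Measure.map_smul, ← Measure.mapₗ_apply_of_measurable hf, map_sum]

theorem uniformMixture_real_apply (κ : Ω → Measure E) [∀ ω, IsFiniteMeasure (κ ω)] (A : Set E) :
    (uniformMixture κ).real A = (Fintype.card Ω : ℝ)⁻¹ * ∑ ω, (κ ω).real A := by
  rw [uniformMixture, measureReal_ennreal_smul_apply, measureReal_def, Measure.finsetSum_apply,
    ENNReal.toReal_sum fun ω _ => measure_ne_top _ _]
  simp [measureReal_def]

theorem isProbabilityMeasure_uniformMixture [Nonempty Ω] (κ : Ω → Measure E)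
    [∀ ω, IsProbabilityMeasure (κ ω)] : IsProbabilityMeasure (uniformMixture κ) := by
  constructor
  rw [uniformMixture, Measure.smul_apply, Measure.finsetSum_apply]
  simp [ENNReal.inv_mul_cancel]

theorem uniformMixture_absolutelyContinuous {κ κ' : Ω → Measure E} (h : ∀ ω, κ ω ≪ κ' ω) :
    uniformMixture κ ≪ uniformMixture κ' := by
  intro A hA
  rw [uniformMixture, Measure.smul_apply, smul_eq_mul, mul_eq_zero] at hA ⊢
  refine hA.imp_right fun hA => ?_
  rw [Measure.finsetSum_apply, Finset.sum_eq_zero_iff] at hA ⊢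
  exact fun ω hω => h ω (hA ω hω)

end

section

variable {p : ℝ} {σ : ℝ≥0}

theorem mixtureOfGaussians_two_real_apply (μ : Fin 2 → ℝ) (hp : 0 ≤ p) (hp1 : p ≤ 1) (A : Set ℝ) :
    (mixtureOfGaussians μ ![1 - p, p] σ).real A =
      (1 - p) * (gaussianReal (μ 0) (σ ^ 2)).real A + p * (gaussianReal (μ 1) (σ ^ 2)).real A := by
  simp only [mixtureOfGaussians, Fin.sum_univ_two, Matrix.cons_val_zero, Matrix.cons_val_one]
  rw [measureReal_add_apply (by simp [ENNReal.mul_eq_top]) (by simp [ENNReal.mul_eq_top]),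
    measureReal_ennreal_smul_apply, measureReal_ennreal_smul_apply,
    ENNReal.toReal_ofReal (by linarith), ENNReal.toReal_ofReal hp]

theorem isProbabilityMeasure_mixtureOfGaussians_two (μ : Fin 2 → ℝ) (hp : 0 ≤ p) (hp1 : p ≤ 1) :
    IsProbabilityMeasure (mixtureOfGaussians μ ![1 - p, p] σ) := by
  constructor
  simp only [mixtureOfGaussians, Fin.sum_univ_two, Matrix.cons_val_zero, Matrix.cons_val_one]
  simp [← ENNReal.ofReal_add (sub_nonneg.2 hp1) hp]

theorem mixtureOfGaussians_absolutelyContinuous {K : ℕ} (hσ : σ ≠ 0) (μ w : Fin K → ℝ) (m : ℝ) :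
    mixtureOfGaussians μ w σ ≪ gaussianReal m (σ ^ 2) := by
  intro A hA
  rw [mixtureOfGaussians, Measure.finsetSum_apply]
  refine Finset.sum_eq_zero fun k _ => ?_
  rw [Measure.smul_apply,
    gaussianReal_absolutelyContinuous_gaussianReal (pow_ne_zero 2 hσ) (μ k) m hA, smul_zero]

theorem absolutelyContinuous_mixtureOfGaussians {K : ℕ} (hσ : σ ≠ 0) (μ : Fin K → ℝ)
    {w : Fin K → ℝ} {k : Fin K} (hw : 0 < w k) (m : ℝ) :
    gaussianReal m (σ ^ 2) ≪ mixtureOfGaussians μ w σ := by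
  intro A hA
  rw [mixtureOfGaussians, Measure.finsetSum_apply, Finset.sum_eq_zero_iff] at hA
  have := hA k (Finset.mem_univ _)
  rw [Measure.smul_apply, smul_eq_mul, mul_eq_zero] at this
  refine gaussianReal_absolutelyContinuous_gaussianReal (pow_ne_zero 2 hσ) m (μ k) ?_
  exact this.resolve_left (ENNReal.ofReal_pos.2 hw).ne'

/-- The component of weight `1 - p` is the reference measure itself, so subtract it and divide by
`p`. The resulting level is exactly the one that amplification consumes. -/
theorem HockeyStickLE.of_mixtureOfGaussians {a b : ℝ} (hp : 0 < p) (hp1 : p ≤ 1)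
    (h : HockeyStickLE a b (mixtureOfGaussians ![0, 2] ![1 - p, p] σ) (gaussianReal 0 (σ ^ 2))) :
    HockeyStickLE (1 + (a - 1) * p⁻¹) (p⁻¹ * b) (gaussianReal 2 (σ ^ 2))
      (gaussianReal 0 (σ ^ 2)) := by
  intro A hA
  have := h A hA
  rw [mixtureOfGaussians_two_real_apply _ hp.le hp1] at this
  simp only [Matrix.cons_val_zero, Matrix.cons_val_one] at this
  refine le_of_mul_le_mul_left ?_ hp
  have e : p * ((1 + (a - 1) * p⁻¹) * (gaussianReal 0 (σ ^ 2)).real A + p⁻¹ * b) =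
      (p + (a - 1)) * (gaussianReal 0 (σ ^ 2)).real A + b := by
    field_simp
  rw [e]
  linarith

/-- A pair of probability measures which is dominated in both directions at all levels `a ≥ 1` is
dominated at all levels. -/
theorem hockeyStick_le_gaussianProfile {E : Type*} [MeasurableSpace E] {P Q : Measure E}
    [IsProbabilityMeasure P] [IsProbabilityMeasure Q] {R : Measure ℝ} [IsProbabilityMeasure R]
    (hR : R ≪ gaussianReal 0 (σ ^ 2)) (hR' : gaussianReal 0 (σ ^ 2) ≪ R)
    (hPQ : ∀ a b : ℝ, 1 ≤ a → HockeyStickLE a b R (gaussianReal 0 (σ ^ 2)) → HockeyStickLE a b P Q)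
    (hQP : ∀ a b : ℝ, 1 ≤ a → HockeyStickLE a b R (gaussianReal 0 (σ ^ 2)) → HockeyStickLE a b Q P)
    (α : ℝ≥0) : hockeyStick α P Q ≤ gaussianProfile R σ α := by
  rw [gaussianProfile]
  split_ifs with hα
  · exact (hPQ _ _ (by exact_mod_cast hα) (hockeyStickLE_toReal α hR)).hockeyStick_le_hockeyStick
  · have h := hockeyStickLE_toReal α hR'
    refine HockeyStickLE.hockeyStick_le_hockeyStick ?_
    set b := (hockeyStick α (gaussianReal 0 (σ ^ 2)) R).toReal
    rcases eq_or_lt_of_le (zero_le (a := α)) with h0 | h0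
    -- Level 0 cannot be inverted, but there the whole space forces the bound to be at least 1.
    · subst h0
      have h1 := h Set.univ MeasurableSet.univ
      intro A _
      have h2 : P.real A ≤ 1 := measureReal_le_one
      simp at h1 ⊢
      linarith
    · have h0' : (0 : ℝ) < α := by exact_mod_cast h0
      have hα1 : (1 : ℝ) ≤ (α : ℝ)⁻¹ := (one_le_inv₀ h0').2 (by exact_mod_cast (not_le.1 hα).le)
      -- Invert to the level `α⁻¹ ≥ 1`, transfer the domination there, and invert back; the two
      -- changes of the additive constant cancel.
      have h3 := (hQP _ _ hα1 (h.symm h0')).symm (inv_pos.2 h0')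
      rw [inv_inv] at h3
      convert h3 using 1
      field_simp
      ring

end

/-! ### The training step as a mixture of isotropic Gaussians -/

section

variable {D LC LF : ℕ} {Z : Type*}

theorem norm_inv_smul_clip_le {C : ℝ} (hC : 0 < C) (g : EuclideanSpace ℝ (Fin D)) :
    ‖C⁻¹ • clip C g‖ ≤ 1 := by
  have h1 : 0 < max 1 (‖g‖ / C) := lt_max_of_lt_left one_pos
  rw [clip, norm_smul, norm_smul, norm_inv, norm_inv, Real.norm_of_nonneg hC.le,
    Real.norm_of_nonneg h1.le, ← mul_assoc, ← mul_inv, inv_mul_le_one₀ (by positivity)]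
  calc ‖g‖ = C * (‖g‖ / C) := by field_simp
    _ ≤ _ := by gcongr; exact le_max_right _ _

/-- The clipped gradient of the crop of `a` with the given start index, in units of `C`. -/
noncomputable def cropGradient {L : ℕ} (C : ℝ)
    (f : EuclideanSpace ℝ (Fin D) → (Fin LC → ℝ) → Z) (ℓ : Z → (Fin LF → ℝ) → ℝ)
    (θ : EuclideanSpace ℝ (Fin D)) (a : Fin L → ℝ) (s : Fin 1 → Fin (L - LF + 1)) :
    EuclideanSpace ℝ (Fin D) :=
  C⁻¹ • clip C (exampleGradient f ℓ θ (crop LC LF a (s 0).val))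

/-- In units of `C` the noise has standard deviation `σ` and each summand norm at most 1. What
remains is an affine map of the output, the same for all datasets and batches. -/
theorem noisyTrainingStep_batch {N L Λ : ℕ} {C η : ℝ} (hC : C ≠ 0) (σ : ℝ≥0)
    (f : EuclideanSpace ℝ (Fin D) → (Fin LC → ℝ) → Z) (ℓ : Z → (Fin LF → ℝ) → ℝ)
    (θ : EuclideanSpace ℝ (Fin D)) (x : Dataset N L) (ω : SamplingSpace N L LF 1) :
    noisyTrainingStep Λ C η σ f ℓ θ (batch LC LF 1 Λ x ω) =
      (isotropicGaussian σ (sampleSum (Finset.univ.filter fun k : Fin N => k.val < Λ)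
        (fun m => cropGradient C f ℓ θ (x m)) ω)).map fun o => θ - (η * (Λ : ℝ)⁻¹ * C) • o := by
  have hsum : ((batch LC LF 1 Λ x ω).map fun yi => clip C (exampleGradient f ℓ θ yi)).sum =
      C • sampleSum (Finset.univ.filter fun k : Fin N => k.val < Λ)
        (fun m => cropGradient C f ℓ θ (x m)) ω := by
    rw [batch, Multiset.map_map]
    change ∑ i ∈ Finset.univ.filter (fun i : Fin N × Fin 1 => i.1.val < Λ / 1),
      clip C (exampleGradient f ℓ θ (crop LC LF (x (ω.1 i.1)) (ω.2 i.1 i.2).val)) = _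
    rw [sampleSum, Finset.smul_sum]
    refine Finset.sum_bij (fun i _ => i.1) ?_ ?_ ?_ ?_
    · intro i hi; simpa using hi
    · intro i _ i' _ h
      exact Prod.ext h (Subsingleton.elim _ _)
    · intro k hk
      exact ⟨(k, 0), by simpa using hk, rfl⟩
    · rintro ⟨k, j⟩ _
      rw [Subsingleton.elim j 0, cropGradient, smul_smul, mul_inv_cancel₀ hC, one_smul]
  rw [noisyTrainingStep, hsum, isotropicGaussian, Measure.map_map (by fun_prop) (by fun_prop)]
  congr 1
  funext z
  simp only [Function.comp, smul_add, smul_smul]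
  congr 3 <;> ring

theorem stepMechanism_eq {N L Λ : ℕ} {C η : ℝ} (hC : C ≠ 0) (σ : ℝ≥0)
    (f : EuclideanSpace ℝ (Fin D) → (Fin LC → ℝ) → Z) (ℓ : Z → (Fin LF → ℝ) → ℝ)
    (θ : EuclideanSpace ℝ (Fin D)) (x : Dataset N L) :
    stepMechanism 1 Λ C η σ f ℓ θ x =
      (uniformMixture fun ω : SamplingSpace N L LF 1 => isotropicGaussian σ
        (sampleSum (Finset.univ.filter fun k : Fin N => k.val < Λ)
          (fun m => cropGradient C f ℓ θ (x m)) ω)).map fun o => θ - (η * (Λ : ℝ)⁻¹ * C) • o := by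
  rw [uniformMixture_map _ (by fun_prop)]
  simp_rw [← noisyTrainingStep_batch hC]
  rfl

instance isProbabilityMeasure_stepMechanism {N L Λ lam : ℕ} {C η : ℝ} (σ : ℝ≥0)
    (f : EuclideanSpace ℝ (Fin D) → (Fin LC → ℝ) → Z) (ℓ : Z → (Fin LF → ℝ) → ℝ)
    (θ : EuclideanSpace ℝ (Fin D)) (x : Dataset N L) :
    IsProbabilityMeasure (stepMechanism lam Λ C η σ f ℓ θ x) := by
  have : ∀ ω : SamplingSpace N L LF lam,
      IsProbabilityMeasure (noisyTrainingStep Λ C η σ f ℓ θ (batch LC LF lam Λ x ω)) :=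
    fun ω => Measure.isProbabilityMeasure_map (by fun_prop)
  exact isProbabilityMeasure_uniformMixture _

theorem stepMechanism_absolutelyContinuous {N L Λ : ℕ} {C η : ℝ} (hC : C ≠ 0) {σ : ℝ≥0}
    (hσ : σ ≠ 0) (f : EuclideanSpace ℝ (Fin D) → (Fin LC → ℝ) → Z) (ℓ : Z → (Fin LF → ℝ) → ℝ)
    (θ : EuclideanSpace ℝ (Fin D)) (x x' : Dataset N L) :
    stepMechanism 1 Λ C η σ f ℓ θ x ≪ stepMechanism 1 Λ C η σ f ℓ θ x' := by
  rw [stepMechanism_eq hC, stepMechanism_eq hC]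
  exact (uniformMixture_absolutelyContinuous fun ω =>
    isotropicGaussian_absolutelyContinuous hσ _ _).map (by fun_prop)

end

/-! ### Crops that see the changed time, and the upper bound -/

theorem EventNeighbor.symm {N L w : ℕ} {x x' : Dataset N L} (h : EventNeighbor w x x') :
    EventNeighbor w x' x := by
  obtain ⟨n, h1, h2, t, h3⟩ := h
  exact ⟨n, fun m hm => (h1 m hm).symm, h2.symm, t, fun s hs => (h3 s hs).symm⟩

theorem crop_eq_of_eq_off {L LC LF : ℕ} {a a' : Fin L → ℝ} {t : Fin L}
    (h : ∀ s, s ≠ t → a s = a' s) {s : ℕ} (hs : ¬(s ≤ LC + t.val ∧ LC + t.val < s + (LC + LF))) :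
    crop LC LF a s = crop LC LF a' s := by
  funext j
  simp only [crop, prependZeros]
  split_ifs with hj
  · refine h _ fun he => hs ?_
    have := congrArg Fin.val he
    simp only at this
    omega
  · rfl

theorem card_filter_crop_le {M LC LF t : ℕ} :
    ((Finset.univ : Finset (Fin M)).filter
      fun s => s.val ≤ LC + t ∧ LC + t < s.val + (LC + LF)).card ≤ LC + LF := by
  rw [← Finset.card_map Fin.valEmbedding]
  calc _ ≤ (Finset.Ioc (LC + t - (LC + LF)) (LC + t)).card ⊔ (LC + LF) := ?_
    _ ≤ LC + LF := by simp; omega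
  -- For `t ≥ LF` the window of start indices has full length; for smaller `t` it is cut off at 0,
  -- and its indices are all below `LC + LF`.
  by_cases h : LC + LF ≤ LC + t
  · refine le_sup_of_le_left (Finset.card_le_card fun i hi => ?_)
    simp only [Finset.mem_map, Finset.mem_filter, Finset.mem_univ, true_and, Finset.mem_Ioc,
      Fin.valEmbedding_apply] at hi ⊢
    obtain ⟨s, hs, rfl⟩ := hi
    omega
  · refine le_sup_of_le_right ?_
    rw [← Finset.card_range (LC + LF)]
    refine Finset.card_le_card fun i hi => ?_
    simp only [Finset.mem_map, Finset.mem_filter, Finset.mem_univ, true_and, Finset.mem_range,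
      Fin.valEmbedding_apply] at hi ⊢
    obtain ⟨s, hs, rfl⟩ := hi
    omega

/-- Probability that a given sequence is sampled with a start index in a given set of `LC + LF`
indices. -/
noncomputable def eventProbability (N L LC LF Λ : ℕ) : ℝ :=
  (Λ * (LC + LF) : ℕ) / (N * (L - LF + 1) : ℕ)

section

variable {N L LC LF Λ : ℕ}

theorem eventProbability_pos (hLF : 1 ≤ LF) (hΛ : 1 ≤ Λ) (hΛN : Λ ≤ N) :
    0 < eventProbability N L LC LF Λ := by
  have : 0 < Λ * (LC + LF) := Nat.mul_pos hΛ (by omega)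
  have : 0 < N * (L - LF + 1) := Nat.mul_pos (by omega) (by omega)
  rw [eventProbability]
  positivity

theorem eventProbability_le_one (hL : LC + LF + LF ≤ L + 1) (hΛN : Λ ≤ N) :
    eventProbability N L LC LF Λ ≤ 1 := by
  refine div_le_one_of_le₀ ?_ (by positivity)
  exact_mod_cast Nat.mul_le_mul hΛN (by omega)

theorem card_positions_labels (hΛN : Λ ≤ N) {T : Finset (Fin 1 → Fin (L - LF + 1))}
    (hT : T.card = LC + LF) :
    (((Finset.univ.filter fun k : Fin N => k.val < Λ) ×ˢ T).card : ℝ) =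
      eventProbability N L LC LF Λ *
        Fintype.card (Fin N × (Fin 1 → Fin (L - LF + 1))) := by
  have h1 : (Finset.univ.filter fun k : Fin N => k.val < Λ).card = Λ := by
    rw [Fin.card_filter_val_lt, min_eq_right hΛN]
  rw [Finset.card_product, h1, hT, Fintype.card_prod, Fintype.card_fin, Fintype.card_fun,
    Fintype.card_fin, Fintype.card_fin, pow_one, eventProbability]
  rcases Nat.eq_zero_or_pos N with h | h
  · have : Λ = 0 := by omega
    simp [h, this]
  · rw [div_mul_cancel₀]
    positivity

end

theorem hockeyStickLE_stepMechanism {N L LC LF Λ D : ℕ} {Z : Type*} {C : ℝ} (η : ℝ) {σ : ℝ≥0}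
    (hLF : 1 ≤ LF) (hL : LC + LF + LF ≤ L + 1) (hΛ : 1 ≤ Λ) (hΛN : Λ ≤ N) (hC : 0 < C)
    (f : EuclideanSpace ℝ (Fin D) → (Fin LC → ℝ) → Z) (ℓ : Z → (Fin LF → ℝ) → ℝ)
    (θ : EuclideanSpace ℝ (Fin D)) {x x' : Dataset N L} (hx : EventNeighbor 1 x x') {a b : ℝ}
    (ha : 1 ≤ a) (h : HockeyStickLE a b (mixtureOfGaussians ![0, 2]
      ![1 - eventProbability N L LC LF Λ, eventProbability N L LC LF Λ] σ)
      (gaussianReal 0 (σ ^ 2))) :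
    HockeyStickLE a b (stepMechanism 1 Λ C η σ f ℓ θ x) (stepMechanism 1 Λ C η σ f ℓ θ x') := by
  have hp := eventProbability_pos (L := L) (LC := LC) hLF hΛ hΛN
  have hp1 := eventProbability_le_one hL hΛN
  set p := eventProbability N L LC LF Λ with hpdef
  obtain ⟨n, hne, -, t, ht⟩ := hx
  -- Near the boundary fewer than `LC + LF` crops may see time `t`. Enlarging the set to exactly
  -- this size gives the same `p` for every `t`; `hL` ensures that there are enough start indices.
  obtain ⟨U, hU, hUcard⟩ := Finset.exists_superset_card_eq
    (card_filter_crop_le (M := L - LF + 1) (LC := LC) (LF := LF) (t := t.val))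
    (by rw [Fintype.card_fin]; omega)
  set T : Finset (Fin 1 → Fin (L - LF + 1)) :=
    U.map (Equiv.funUnique (Fin 1) (Fin (L - LF + 1))).symm.toEmbedding with hT
  have hTcard : T.card = LC + LF := by rw [hT, Finset.card_map, hUcard]
  have hcard := card_positions_labels hΛN hTcard
  rw [← hpdef] at hcard
  have hN : 0 < N := by omega
  have hI : (0 : ℝ) < Fintype.card (Fin N × (Fin 1 → Fin (L - LF + 1))) := by
    have : Nonempty (Fin N) := ⟨⟨0, hN⟩⟩
    exact_mod_cast Fintype.card_pos
  rw [stepMechanism_eq hC.ne', stepMechanism_eq hC.ne']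
  refine HockeyStickLE.map ?_ (by fun_prop)
  intro A hA
  have hsum := sum_isotropicGaussian_sampleSum_le
    (K := Finset.univ.filter fun k : Fin N => k.val < Λ) ⟨⟨0, hN⟩, by simp; omega⟩
    (Finset.card_pos.1 (by rw [hTcard]; omega) : T.Nonempty)
    (G := fun m => cropGradient C f ℓ θ (x m)) (G' := fun m => cropGradient C f ℓ θ (x' m)) n
    (fun m s => norm_inv_smul_clip_le hC _) (fun m s => norm_inv_smul_clip_le hC _)
    (fun m hm => by simp only [hne m hm]) (fun s hs => ?_) (σ := σ) ha (b := p⁻¹ * b) ?_ hA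
  · rw [hcard] at hsum
    rw [uniformMixture_real_apply, uniformMixture_real_apply]
    have hΩ : (0 : ℝ) < Fintype.card (SamplingSpace N L LF 1) := by
      exact_mod_cast Fintype.card_pos
    refine le_of_mul_le_mul_left ?_ (mul_pos hI hΩ)
    refine le_of_eq_of_le ?_ (hsum.trans_eq ?_)
    · field_simp
    · field_simp
  · have : s 0 ∉ U := fun h0 => hs <| by
      rw [hT, Finset.mem_map_equiv]
      exact h0
    simp only [cropGradient]
    rw [crop_eq_of_eq_off (t := t) (a' := x' n)]
    · intro s' hs'
      refine ht s' fun h' => hs' (Fin.ext (by omega))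
    · intro h'
      exact this (hU (by simpa using h'))
  · rw [hcard]
    convert h.of_mixtureOfGaussians hp hp1 using 1
    field_simp

theorem stepProfile_le_gaussianProfile {N L LC LF Λ D : ℕ} {Z : Type*} {C : ℝ} (η : ℝ) {σ : ℝ≥0}
    (hLF : 1 ≤ LF) (hL : LC + LF + LF ≤ L + 1) (hΛ : 1 ≤ Λ) (hΛN : Λ ≤ N) (hC : 0 < C)
    (hσ : σ ≠ 0)
    (f : EuclideanSpace ℝ (Fin D) → (Fin LC → ℝ) → Z) (ℓ : Z → (Fin LF → ℝ) → ℝ)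
    (θ : EuclideanSpace ℝ (Fin D)) (α : ℝ≥0) :
    stepProfile 1 N L 1 Λ C η σ f ℓ θ α ≤ gaussianProfile (mixtureOfGaussians ![0, 2]
      ![1 - eventProbability N L LC LF Λ, eventProbability N L LC LF Λ] σ) σ α := by
  have hp := eventProbability_pos (L := L) (LC := LC) hLF hΛ hΛN
  have hp1 := eventProbability_le_one hL hΛN
  have := isProbabilityMeasure_mixtureOfGaussians_two (σ := σ) ![0, 2] hp.le hp1
  refine iSup_le fun x => iSup_le fun x' => iSup_le fun hx => ?_
  exact hockeyStick_le_gaussianProfile (mixtureOfGaussians_absolutelyContinuous hσ _ _ _)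
    (absolutelyContinuous_mixtureOfGaussians hσ _ (k := 1) hp _)
    (fun a b => hockeyStickLE_stepMechanism η hLF hL hΛ hΛN hC f ℓ θ hx)
    (fun a b => hockeyStickLE_stepMechanism η hLF hL hΛ hΛN hC f ℓ θ hx.symm) α

/-! ### Exact laws of coordinates and of a single item -/

theorem uniformMixture_const {Ω E : Type*} [Fintype Ω] [Nonempty Ω] [MeasurableSpace E]
    (μ : Measure E) : uniformMixture (fun _ : Ω => μ) = μ := by
  rw [uniformMixture, Finset.sum_const, Finset.card_univ, ← Nat.cast_smul_eq_nsmul ℝ≥0∞, smul_smul,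
    ENNReal.inv_mul_cancel (by simp) (by simp), one_smul]

theorem map_isotropicGaussian_coord {D : ℕ} (σ : ℝ≥0) (m : EuclideanSpace ℝ (Fin D)) (i : Fin D)
    (c : ℝ) : (isotropicGaussian σ m).map (fun o => o i + c) = gaussianReal (m i + c) (σ ^ 2) := by
  have hf : (fun o : EuclideanSpace ℝ (Fin D) => o i + c) ∘ (fun z => m + (σ : ℝ) • z) =
      (fun t => (m i + c) + t) ∘ (fun t => (σ : ℝ) * t) ∘ fun z => z i := by
    funext z
    simp
    ring
  rw [isotropicGaussian, Measure.map_map (by fun_prop) (by fun_prop), hf,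
    ← Measure.map_map (by fun_prop) (by fun_prop), ← Measure.map_map (by fun_prop) (by fun_prop),
    map_stdGaussian_coord, gaussianReal_map_const_mul, gaussianReal_map_const_add]
  congr 1
  · ring
  · ext; simp

section

variable {ι S : Type*} [DecidableEq ι] [DecidableEq S]

theorem sampleSum_ite_eq {V : Type*} [AddCommMonoid V] (K : Finset ι) (T : Finset S)
    (n : ι) (v : V) (ω : Equiv.Perm ι × (ι → S)) :
    sampleSum K (fun m s => if m = n ∧ s ∈ T then v else 0) ω =
      if (ω.1.symm n, ω.2 (ω.1.symm n)) ∈ K ×ˢ T then v else 0 := by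
  have h : ∀ k, (if ω.1 k = n ∧ ω.2 k ∈ T then v else 0) =
      if ω.1.symm n = k then (if ω.2 (ω.1.symm n) ∈ T then v else 0) else 0 := by
    intro k
    by_cases hk : ω.1.symm n = k
    · have : ω.1 k = n := by rw [← hk]; simp
      simp [hk, this]
    · have : ω.1 k ≠ n := fun h => hk (by rw [← h]; simp)
      simp [hk, this]
  simp only [sampleSum, h, Finset.sum_ite_eq, Finset.mem_product]
  split_ifs <;> simp_all

end

section

variable {ι S : Type*} [DecidableEq ι] [Fintype ι] [Fintype S]

/-- The position and label of a fixed item are jointly uniform, which is `sum_relocate` for a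
function of these two data only. The reference position is then irrelevant, and `n` merely serves as
one. -/
theorem uniformMixture_item {E : Type*} [MeasurableSpace E] [Nonempty S] (n : ι)
    (κ : ι × S → Measure E) [∀ js, IsFiniteMeasure (κ js)] (A : Set E) :
    (uniformMixture fun ω : Equiv.Perm ι × (ι → S) =>
      κ (ω.1.symm n, ω.2 (ω.1.symm n))).real A = (uniformMixture κ).real A := by
  have h := sum_relocate n n fun ω : Equiv.Perm ι × (ι → S) =>
    (κ (ω.1.symm n, ω.2 (ω.1.symm n))).real A
  simp only [relocate_fst_symm, relocate_snd_self] at h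
  rw [Finset.sum_const, nsmul_eq_mul, nsmul_eq_mul, Finset.card_univ] at h
  rw [uniformMixture_real_apply, uniformMixture_real_apply]
  have : Nonempty ι := ⟨n⟩
  have h1 : (Fintype.card (Equiv.Perm ι × (ι → S)) : ℝ) ≠ 0 := by
    exact_mod_cast Fintype.card_ne_zero
  have h2 : (Fintype.card (ι × S) : ℝ) ≠ 0 := by exact_mod_cast Fintype.card_ne_zero
  rw [inv_mul_eq_div, inv_mul_eq_div, div_eq_div_iff h1 h2]
  linarith

theorem uniformMixture_item_gaussianReal [Nonempty S] [DecidableEq S] (n : ι) (K : Finset ι)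
    (T : Finset S) {p : ℝ} (hp : 0 ≤ p) (hp1 : p ≤ 1)
    (hcard : ((K ×ˢ T).card : ℝ) = p * Fintype.card (ι × S)) (σ : ℝ≥0) (μ : Fin 2 → ℝ) :
    (uniformMixture fun ω : Equiv.Perm ι × (ι → S) => gaussianReal
      (if (ω.1.symm n, ω.2 (ω.1.symm n)) ∈ K ×ˢ T then μ 1 else μ 0) (σ ^ 2)) =
      mixtureOfGaussians μ ![1 - p, p] σ := by
  have : Nonempty ι := ⟨n⟩
  have := isProbabilityMeasure_mixtureOfGaussians_two (σ := σ) μ hp hp1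
  let κ : ι × S → Measure ℝ := fun js =>
    gaussianReal (if js ∈ K ×ˢ T then μ 1 else μ 0) (σ ^ 2)
  have hκ : ∀ js, IsProbabilityMeasure (κ js) := fun js => inferInstance
  have := isProbabilityMeasure_uniformMixture fun ω : Equiv.Perm ι × (ι → S) =>
    κ (ω.1.symm n, ω.2 (ω.1.symm n))
  refine Measure.ext fun A _ => ?_
  refine (ENNReal.toReal_eq_toReal_iff' (measure_ne_top _ _) (measure_ne_top _ _)).1 ?_
  refine (uniformMixture_item n κ A).trans ?_
  change _ = (mixtureOfGaussians μ ![1 - p, p] σ).real A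
  rw [uniformMixture_real_apply, mixtureOfGaussians_two_real_apply μ hp hp1]
  have hsum : ∑ js, (κ js).real A = ((K ×ˢ T).card : ℝ) * (gaussianReal (μ 1) (σ ^ 2)).real A +
      (Fintype.card (ι × S) - (K ×ˢ T).card) * (gaussianReal (μ 0) (σ ^ 2)).real A := by
    have h1 : ∀ js, (κ js).real A = (gaussianReal (μ 0) (σ ^ 2)).real A +
        if js ∈ K ×ˢ T then (gaussianReal (μ 1) (σ ^ 2)).real A -
          (gaussianReal (μ 0) (σ ^ 2)).real A else 0 := by
      intro js
      by_cases h : js ∈ K ×ˢ T <;> simp only [κ, h, if_true, if_false] <;> ring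
    simp only [h1, Finset.sum_add_distrib, Finset.sum_ite_mem, Finset.univ_inter,
      Finset.sum_const, nsmul_eq_mul, Finset.card_univ]
    ring
  rw [hsum, hcard]
  have h2 : (Fintype.card (ι × S) : ℝ) ≠ 0 := by exact_mod_cast Fintype.card_ne_zero
  field_simp
  ring

end

/-! ### The extremal model and datasets -/

section

open Classical in
/-- The sign `1` if the vector contains the marker value `-1`, and `-1` otherwise. -/
noncomputable def markerSign {k : ℕ} (v : Fin k → ℝ) : ℝ :=
  if ∃ j, v j = -1 then 1 else -1

theorem abs_markerSign {k : ℕ} (v : Fin k → ℝ) : |markerSign v| = 1 := by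
  unfold markerSign
  split_ifs <;> simp

/-- Model whose forecast is linear in one parameter, with the sign of the slope depending on
whether the context window contains the marker. -/
noncomputable def markerModel {D LC : ℕ} (LF : ℕ) (C : ℝ) (i : Fin D)
    (ϑ : EuclideanSpace ℝ (Fin D)) (c : Fin LC → ℝ) : Fin LF → ℝ :=
  fun _ => markerSign c * C * ϑ i

/-- Loss which flips the sign of the forecast if the target contains the marker. -/
noncomputable def markerLoss {LF : ℕ} (j : Fin LF) (z y : Fin LF → ℝ) : ℝ :=
  -markerSign y * z j

variable {D LC LF : ℕ} {C : ℝ} (i : Fin D) (j : Fin LF)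

theorem hasGradientAt_const_mul_coord (c : ℝ) (θ : EuclideanSpace ℝ (Fin D)) :
    HasGradientAt (fun ϑ : EuclideanSpace ℝ (Fin D) => c * ϑ i) (c • EuclideanSpace.single i 1)
      θ := by
  rw [hasGradientAt_iff_hasFDerivAt]
  have h : InnerProductSpace.toDual ℝ (EuclideanSpace ℝ (Fin D)) (c • EuclideanSpace.single i 1) =
      c • EuclideanSpace.proj (𝕜 := ℝ) i := by
    ext z
    simp [EuclideanSpace.inner_single_left]
  rw [h]
  exact ((EuclideanSpace.proj (𝕜 := ℝ) i).hasFDerivAt (x := θ)).const_mul c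

theorem differentiableLoss_marker :
    DifferentiableLoss (LC := LC) (markerModel LF C i) (markerLoss j) := by
  intro c y θ
  simp only [markerModel, markerLoss, ← mul_assoc]
  exact (hasGradientAt_const_mul_coord i _ θ).differentiableAt

/-- The gradient has norm exactly `C`, so clipping is inactive and every example contributes a
signed unit vector along one axis. -/
theorem inv_smul_clip_exampleGradient_marker (hC : 0 < C) (θ : EuclideanSpace ℝ (Fin D))
    (y : Fin (LC + LF) → ℝ) :
    C⁻¹ • clip C (exampleGradient (markerModel LF C i) (markerLoss j) θ y) =
      (-(markerSign (fun k => y (Fin.natAdd LC k)) * markerSign (fun k => y (Fin.castAdd LF k)))) •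
        EuclideanSpace.single i 1 := by
  have hg : exampleGradient (markerModel LF C i) (markerLoss j) θ y =
      (-markerSign (fun k => y (Fin.natAdd LC k)) * markerSign (fun k => y (Fin.castAdd LF k)) * C) •
        EuclideanSpace.single i 1 := by
    have := (hasGradientAt_const_mul_coord i (-markerSign (fun k => y (Fin.natAdd LC k)) *
      markerSign (fun k => y (Fin.castAdd LF k)) * C) θ).gradient
    rw [← this, exampleGradient]
    congr 1
    funext ϑ
    simp only [markerModel, markerLoss]
    ring
  have hn : ‖(-markerSign (fun k => y (Fin.natAdd LC k)) *
      markerSign (fun k => y (Fin.castAdd LF k)) * C) •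
        (EuclideanSpace.single i 1 : EuclideanSpace ℝ (Fin D))‖ = C := by
    rw [norm_smul, Real.norm_eq_abs, abs_mul, abs_mul, abs_neg, abs_markerSign, abs_markerSign,
      abs_of_pos hC]
    simp
  rw [hg, clip, hn, div_self hC.ne', max_self, inv_one, one_smul, smul_smul]
  congr 1
  field_simp

theorem markerSign_mul_markerSign_of_forall_ne {y : Fin (LC + LF) → ℝ} (h : ∀ k, y k ≠ -1) :
    markerSign (fun k => y (Fin.natAdd LC k)) * markerSign (fun k => y (Fin.castAdd LF k)) = 1 := by
  simp [markerSign, h]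

/-- A single marker lies in the context or in the forecast window but not in both, so exactly one of
the two signs flips. The model sees only the former and the loss only the latter; their product
detects both cases. -/
theorem markerSign_mul_markerSign_of_unique {y : Fin (LC + LF) → ℝ} {k₀ : Fin (LC + LF)}
    (h : ∀ k, y k = -1 ↔ k = k₀) :
    markerSign (fun k => y (Fin.natAdd LC k)) * markerSign (fun k => y (Fin.castAdd LF k)) = -1 := by
  simp only [markerSign, h]
  induction k₀ using Fin.addCases with
  | left k₀ =>
    have h1 : ¬∃ k : Fin LF, Fin.natAdd LC k = Fin.castAdd LF k₀ := by
      rintro ⟨k, hk⟩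
      have := congrArg Fin.val hk
      simp at this
      omega
    simp [h1]
  | right k₀ =>
    have h1 : ¬∃ k : Fin LC, Fin.castAdd LF k = Fin.natAdd LC k₀ := by
      rintro ⟨k, hk⟩
      have := congrArg Fin.val hk
      simp at this
      omega
    simp [h1]

end

/-- Constant sequences, pairwise distinct and nonnegative. -/
def constantDataset (N : ℕ) {L : ℕ} (t : Fin L) : Dataset N L :=
  ⟨fun m _ => m.val, fun m m' h => Fin.ext (by simpa using congrFun h t)⟩

/-- Constant sequences, except for a single marker value `-1` in the sequence `n` at time `t`. -/
def markedDataset {N L : ℕ} (n : Fin N) (t : Fin L) : Dataset N L :=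
  ⟨fun m s => if m = n ∧ s = t then -1 else m.val, fun m m' h => by
    have h' := congrFun h t
    have hneg : ∀ k : ℕ, (k : ℝ) ≠ -1 := fun k hk => by
      have : (0 : ℝ) ≤ k := k.cast_nonneg
      linarith
    by_cases hm : m = n <;> by_cases hm' : m' = n
    · rw [hm, hm']
    · simp [hm, hm'] at h'
      exact absurd h'.symm (hneg _)
    · simp [hm, hm'] at h'
      exact absurd h' (hneg _)
    · simp [hm, hm'] at h'
      exact Fin.ext h'⟩

section

variable {N L LC LF : ℕ} {n : Fin N} {t : Fin L}

theorem constantDataset_apply (m : Fin N) (s : Fin L) : constantDataset N t m s = m.val := rfl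

theorem markedDataset_apply (m : Fin N) (s : Fin L) :
    markedDataset n t m s = if m = n ∧ s = t then -1 else (m.val : ℝ) := rfl

theorem eventNeighbor_markedDataset : EventNeighbor 1 (markedDataset n t) (constantDataset N t) := by
  refine ⟨n, fun m hm => ?_, fun h => ?_, t, fun s hs => ?_⟩
  · funext s
    simp [markedDataset_apply, constantDataset_apply, hm]
  · have := congrFun h t
    simp [markedDataset_apply, constantDataset_apply] at this
    have h0 : (0 : ℝ) ≤ (n.val : ℝ) := Nat.cast_nonneg _
    linarith
  · have : s ≠ t := fun h => hs (by rw [h]; omega)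
    simp [markedDataset_apply, constantDataset_apply, this]

theorem crop_constantDataset_ne (m : Fin N) (s : ℕ) (k : Fin (LC + LF)) :
    crop LC LF (constantDataset N t m) s k ≠ -1 := by
  have h0 : (0 : ℝ) ≤ crop LC LF (constantDataset N t m) s k := by
    simp only [crop, prependZeros, constantDataset_apply]
    split_ifs
    · exact Nat.cast_nonneg _
    · exact le_rfl
  linarith

theorem crop_markedDataset_eq_iff (m : Fin N) (s : ℕ) (k : Fin (LC + LF)) :
    crop LC LF (markedDataset n t m) s k = -1 ↔ m = n ∧ s + k.val = LC + t.val := by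
  simp only [crop, prependZeros, markedDataset_apply]
  have hneg : (m.val : ℝ) ≠ -1 := fun hk => by
    have : (0 : ℝ) ≤ (m.val : ℝ) := Nat.cast_nonneg _
    linarith
  split_ifs with h1 h2
  · simp only [true_iff]
    refine ⟨h2.1, ?_⟩
    have := congrArg Fin.val h2.2
    simp only at this
    omega
  · simp only [hneg, false_iff]
    rintro ⟨h3, h4⟩
    exact h2 ⟨h3, Fin.ext (by simp only; omega)⟩
  · norm_num
    intro _ h4
    have := t.2
    omega

end

section

variable {N L LC LF D : ℕ} {C : ℝ} (i : Fin D) (j : Fin LF) {n : Fin N} {t : Fin L}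

theorem cropGradient_constantDataset (hC : 0 < C) (θ : EuclideanSpace ℝ (Fin D)) (m : Fin N)
    (s : Fin 1 → Fin (L - LF + 1)) :
    cropGradient (LC := LC) C (markerModel LF C i) (markerLoss j) θ (constantDataset N t m) s =
      (-1 : ℝ) • EuclideanSpace.single i 1 := by
  rw [cropGradient, inv_smul_clip_exampleGradient_marker i j hC,
    markerSign_mul_markerSign_of_forall_ne fun k => crop_constantDataset_ne m _ k]

/-- At time `LF - 1` the marker has padded position `LC + LF - 1`, which is seen by precisely the
starts below `LC + LF`. The number of such starts thus attains the maximum. -/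
theorem cropGradient_markedDataset (hC : 0 < C) (θ : EuclideanSpace ℝ (Fin D))
    (ht : t.val + 1 = LF) (m : Fin N) (s : Fin 1 → Fin (L - LF + 1)) :
    cropGradient (LC := LC) C (markerModel LF C i) (markerLoss j) θ (markedDataset n t m) s =
      ((-1 : ℝ) + if m = n ∧ s ∈ Finset.univ.filter (fun s : Fin 1 → Fin (L - LF + 1) =>
        (s 0).val < LC + LF) then 2 else 0) • EuclideanSpace.single i 1 := by
  rw [cropGradient, inv_smul_clip_exampleGradient_marker i j hC]
  simp only [Finset.mem_filter, Finset.mem_univ, true_and]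
  split_ifs with h
  · rw [markerSign_mul_markerSign_of_unique (k₀ := ⟨LC + t.val - (s 0).val, by omega⟩)]
    · norm_num
    · intro k
      rw [crop_markedDataset_eq_iff, Fin.ext_iff (a := k)]
      have := h.2
      simp only [h.1, true_and]
      omega
  · rw [markerSign_mul_markerSign_of_forall_ne]
    · norm_num
    · intro k hk
      rw [crop_markedDataset_eq_iff] at hk
      exact h ⟨hk.1, by omega⟩

end

/-! ### Tightness and conclusion -/

theorem map_stepMechanism_coord {N L LC LF Λ D : ℕ} {Z : Type*} {C η : ℝ} (hC : C ≠ 0)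
    (hη : η ≠ 0) (hΛ : Λ ≠ 0) (σ : ℝ≥0)
    (f : EuclideanSpace ℝ (Fin D) → (Fin LC → ℝ) → Z) (ℓ : Z → (Fin LF → ℝ) → ℝ)
    (θ : EuclideanSpace ℝ (Fin D)) (x : Dataset N L) (i : Fin D) (c : ℝ) :
    (stepMechanism 1 Λ C η σ f ℓ θ x).map
      (fun o => (η * (Λ : ℝ)⁻¹ * C)⁻¹ * (θ i - o i) + c) =
      uniformMixture fun ω : SamplingSpace N L LF 1 => gaussianReal
        (sampleSum (Finset.univ.filter fun k : Fin N => k.val < Λ)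
          (fun m s => cropGradient C f ℓ θ (x m) s i) ω + c) (σ ^ 2) := by
  have h0 : η * (Λ : ℝ)⁻¹ * C ≠ 0 :=
    mul_ne_zero (mul_ne_zero hη (inv_ne_zero (Nat.cast_ne_zero.2 hΛ))) hC
  have hcomp : (fun o : EuclideanSpace ℝ (Fin D) =>
      (η * (Λ : ℝ)⁻¹ * C)⁻¹ * (θ i - o i) + c) ∘ (fun o => θ - (η * (Λ : ℝ)⁻¹ * C) • o) =
      fun o => o i + c := by
    funext o
    simp only [Function.comp, PiLp.sub_apply, PiLp.smul_apply, smul_eq_mul, sub_sub_cancel]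
    rw [inv_mul_cancel_left₀ h0]
  rw [stepMechanism_eq hC, Measure.map_map (by fun_prop) (by fun_prop), hcomp,
    uniformMixture_map _ (by fun_prop)]
  simp_rw [map_isotropicGaussian_coord]
  congr 1
  funext ω
  congr 2
  simp [sampleSum]

section

variable {N L LC LF Λ D : ℕ} {C η : ℝ} (i : Fin D) (j : Fin LF) {n : Fin N} {t : Fin L}

theorem card_filter_start_lt (hL : LC + LF + LF ≤ L + 1) :
    (Finset.univ.filter fun s : Fin 1 → Fin (L - LF + 1) => (s 0).val < LC + LF).card =
      LC + LF := by
  have h : (Finset.univ.filter fun s : Fin (L - LF + 1) => s.val < LC + LF).card = LC + LF := by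
    rw [Fin.card_filter_val_lt]
    omega
  refine Eq.trans ?_ h
  exact Finset.card_equiv (Equiv.funUnique (Fin 1) (Fin (L - LF + 1))) (by simp)

theorem map_stepMechanism_constantDataset (hC : 0 < C) (hη : η ≠ 0) (hΛ : Λ ≠ 0) (hΛN : Λ ≤ N)
    (σ : ℝ≥0) (θ : EuclideanSpace ℝ (Fin D)) :
    (stepMechanism 1 Λ C η σ (markerModel (LC := LC) LF C i) (markerLoss j) θ
      (constantDataset N t)).map (fun o => (η * (Λ : ℝ)⁻¹ * C)⁻¹ * (θ i - o i) + Λ) =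
      gaussianReal 0 (σ ^ 2) := by
  rw [map_stepMechanism_coord hC.ne' hη hΛ]
  simp_rw [cropGradient_constantDataset i j hC]
  have hcardK : (Finset.univ.filter fun k : Fin N => k.val < Λ).card = Λ := by
    rw [Fin.card_filter_val_lt, min_eq_right hΛN]
  simp only [sampleSum, PiLp.smul_apply, Finset.sum_const, hcardK]
  have : Nonempty (Fin N) := ⟨⟨0, by omega⟩⟩
  simp [uniformMixture_const]

/-- All `Λ` examples contribute `-1`, which the shift by `Λ` cancels; drawing the marked crop
changes one contribution to `+1`, moving the mean to 2. -/
theorem map_stepMechanism_markedDataset (hLF : 1 ≤ LF) (hL : LC + LF + LF ≤ L + 1) (hC : 0 < C)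
    (hη : η ≠ 0) (hΛ : 1 ≤ Λ) (hΛN : Λ ≤ N) (σ : ℝ≥0) (θ : EuclideanSpace ℝ (Fin D))
    (ht : t.val + 1 = LF) :
    (stepMechanism 1 Λ C η σ (markerModel (LC := LC) LF C i) (markerLoss j) θ
      (markedDataset n t)).map (fun o => (η * (Λ : ℝ)⁻¹ * C)⁻¹ * (θ i - o i) + Λ) =
      mixtureOfGaussians ![0, 2]
        ![1 - eventProbability N L LC LF Λ, eventProbability N L LC LF Λ] σ := by
  rw [map_stepMechanism_coord hC.ne' hη (by omega)]
  simp_rw [cropGradient_markedDataset i j hC θ ht]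
  have hcardK : (Finset.univ.filter fun k : Fin N => k.val < Λ).card = Λ := by
    rw [Fin.card_filter_val_lt, min_eq_right hΛN]
  rw [← uniformMixture_item_gaussianReal n _ _ (eventProbability_pos hLF hΛ hΛN).le
    (eventProbability_le_one hL hΛN) (card_positions_labels hΛN (card_filter_start_lt hL)) σ ![0, 2]]
  congr 1
  funext ω
  congr 1
  simp only [PiLp.smul_apply, smul_eq_mul, PiLp.single_apply, if_true, mul_one]
  have hsplit := sampleSum_ite_eq (Finset.univ.filter fun k : Fin N => k.val < Λ)
    (Finset.univ.filter fun s : Fin 1 → Fin (L - LF + 1) => (s 0).val < LC + LF) n (2 : ℝ) ω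
  simp only [sampleSum] at hsplit
  simp only [sampleSum, Finset.sum_add_distrib]
  rw [hsplit, Finset.sum_const, hcardK]
  simp

end

/-- One pair of datasets serves all levels: marked against constant for `α ≥ 1`, and the reverse
order for `α < 1`. -/
theorem gaussianProfile_le_stepProfile_marker {N L LC LF Λ D : ℕ} {C η : ℝ} {σ : ℝ≥0}
    (hLF : 1 ≤ LF) (hL : LC + LF + LF ≤ L + 1) (hΛ : 1 ≤ Λ) (hΛN : Λ ≤ N) (hC : 0 < C)
    (hη : η ≠ 0) (hσ : σ ≠ 0) (θ : EuclideanSpace ℝ (Fin D)) (i : Fin D) (j : Fin LF) (α : ℝ≥0) :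
    gaussianProfile (mixtureOfGaussians ![0, 2]
      ![1 - eventProbability N L LC LF Λ, eventProbability N L LC LF Λ] σ) σ α ≤
      stepProfile 1 N L 1 Λ C η σ (markerModel (LC := LC) LF C i) (markerLoss j) θ α := by
  let n : Fin N := ⟨0, by omega⟩
  let t : Fin L := ⟨LF - 1, by omega⟩
  have ht : t.val + 1 = LF := Nat.sub_add_cancel hLF
  have hx : EventNeighbor 1 (markedDataset n t) (constantDataset N t) := eventNeighbor_markedDataset
  have hmeas : Measurable fun o : EuclideanSpace ℝ (Fin D) =>
      (η * (Λ : ℝ)⁻¹ * C)⁻¹ * (θ i - o i) + Λ := by fun_prop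
  have hac := stepMechanism_absolutelyContinuous (N := N) (L := L) (Λ := Λ) (η := η) hC.ne' hσ
    (markerModel (LC := LC) LF C i) (markerLoss j) θ
  rw [gaussianProfile, ← map_stepMechanism_constantDataset (LC := LC) (t := t) i j hC hη
    (by omega) hΛN σ θ, ← map_stepMechanism_markedDataset (n := n) i j hLF hL hC hη hΛ hΛN σ θ ht]
  have := fun x : Dataset N L => Measure.isProbabilityMeasure_map (μ := stepMechanism 1 Λ C η σ
    (markerModel (LC := LC) LF C i) (markerLoss j) θ x) hmeas.aemeasurable
  split_ifs
  · exact ((hockeyStickLE_toReal α (hac _ _)).map hmeas).hockeyStick_le_hockeyStick.trans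
      (le_iSup_of_le _ (le_iSup_of_le _ (le_iSup_of_le hx le_rfl)))
  · exact ((hockeyStickLE_toReal α (hac _ _)).map hmeas).hockeyStick_le_hockeyStick.trans
      (le_iSup_of_le _ (le_iSup_of_le _ (le_iSup_of_le hx.symm le_rfl)))

theorem eventProbability_eq {N L LC LF Λ : ℕ} (hLF : 1 ≤ LF) (hL : LC + LF + LF ≤ L + 1) :
    eventProbability N L LC LF Λ =
      (Λ : ℝ) / N * (((LC : ℝ) + LF) / ((L : ℝ) - LF + 1)) := by
  rw [eventProbability, div_mul_div_comm]
  push_cast [Nat.cast_sub (show LF ≤ L by omega)]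
  rfl

theorem theorem4p4 (L LC LF N lam Λ D : ℕ) (C η : ℝ) (σ : ℝ≥0)
    (hlam : lam = 1) (hLF : 1 ≤ LF) (hL : LC + LF + LF ≤ L + 1)
    (hΛ : 1 ≤ Λ) (hΛN : Λ ≤ N) (hD : 1 ≤ D)
    (hC : 0 < C) (hη : 0 < η) (hσ : 0 < σ)
    (r ρ : ℝ)
    (hr : r = ((LC : ℝ) + LF) / ((L : ℝ) - LF + 1))
    (hρ : ρ = ((Λ / lam : ℕ) : ℝ) / N)
    (Ptilde : Measure ℝ)
    (hP : Ptilde = mixtureOfGaussians ![0, 2] ![(1 - ρ) + ρ * (1 - r), ρ * r] σ)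
    (θ : EuclideanSpace ℝ (Fin D)) :
    -- the privacy profile of the training step with an arbitrary model
    (∀ α : ℝ≥0, worstCaseStepProfile 1 N L LC LF lam Λ C η σ θ α = gaussianProfile Ptilde σ α) ∧
    -- no model and loss, with any space of predictions, exceeds it
    (∀ (Z : Type*) (f : EuclideanSpace ℝ (Fin D) → (Fin LC → ℝ) → Z) (ℓ : Z → (Fin LF → ℝ) → ℝ)
      (α : ℝ≥0), stepProfile 1 N L lam Λ C η σ f ℓ θ α ≤ gaussianProfile Ptilde σ α) ∧
    -- a single model and loss has exactly this profile
    (∃ (f : EuclideanSpace ℝ (Fin D) → (Fin LC → ℝ) → (Fin LF → ℝ))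
      (ℓ : (Fin LF → ℝ) → (Fin LF → ℝ) → ℝ), DifferentiableLoss f ℓ ∧
      ∀ α : ℝ≥0, stepProfile 1 N L lam Λ C η σ f ℓ θ α = gaussianProfile Ptilde σ α) := by
  subst hlam
  have hp : ρ * r = eventProbability N L LC LF Λ := by
    rw [eventProbability_eq hLF hL, hr, hρ, Nat.div_one]
  have hw : (1 - ρ) + ρ * (1 - r) = 1 - eventProbability N L LC LF Λ := by
    rw [← hp]; ring
  rw [hw, hp] at hP
  subst hP
  have upper := fun f (ℓ : (Fin LF → ℝ) → (Fin LF → ℝ) → ℝ) α =>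
    stepProfile_le_gaussianProfile η hLF hL hΛ hΛN hC hσ.ne' f ℓ θ α
  have lower := gaussianProfile_le_stepProfile_marker hLF hL hΛ hΛN hC hη.ne' hσ.ne' θ
    (⟨0, hD⟩ : Fin D) (⟨0, hLF⟩ : Fin LF)
  have hdiff := differentiableLoss_marker (LC := LC) (C := C) (⟨0, hD⟩ : Fin D)
    (⟨0, hLF⟩ : Fin LF)
  refine ⟨fun α => le_antisymm ?_ ?_, fun Z f ℓ α =>
    stepProfile_le_gaussianProfile η hLF hL hΛ hΛN hC hσ.ne' f ℓ θ α, _, _, hdiff, fun α =>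
    le_antisymm (upper _ _ α) (lower α)⟩
  · exact iSup_le fun f => iSup_le fun ℓ => iSup_le fun _ => upper f ℓ α
  · exact (lower α).trans (le_iSup_of_le _ (le_iSup_of_le _ (le_iSup_of_le hdiff le_rfl)))
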